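/- **Setting.** An energy game is played on a finite directed graph $G=(V,E)$ with $n=|V|\ge 1$ nodes and $m=|E|$ edges, in which every node has out-degree at least one, with integer edge weights $w$ and a partition of $V$ into Alice's nodes $V_A$ and Bob's nodes $V_B$. A (positional) strategy $\sigma$ of Alice (resp. $\tau$ of Bob) selects one out-edge at each node of $V_A$ (resp. $V_B$). In the graph $G(\sigma,\tau)$ of selected edges, let $C$ be the unique cycle reachable from $s$. Put $e^*_{G(\sigma,\tau),w}(s)=\infty$ if $w(C)<0$, and otherwise $e^*_{G(\sigma,\tau),w}(s)=\max\{0,-\min_P w(P)\}$ over the simple paths $P$ from $s$ in $G(\sigma,\tau)$. The *minimal energy* of $s$ is $e^*_{G,w}(s)=\min_\sigma\max_\tau e^*_{G(\sigma,\tau),w}(s)$. A natural number $M$ is an *upper bound on the finite minimal energies* if $e^*_{G,w}(v)=\infty$ or $e^*_{G,w}(v)\le M$ for every node $v$. A strategy $\tau^*$ of Bob is *optimal at $s$* if $e^*_{G(\sigma,\tau^*),w}(s)\ge e^*_{G,w}(s)$ for all $\sigma$. The node $s$ *has a penalty of at least $D\ge 0$* if there is a $\tau^*$ optimal at $s$ such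 that, for every $\sigma$, the cycle $C$ reachable from $s$ in $G(\sigma,\tau^*)$ satisfies: if $w(C)<0$, then $w(C)/|C|\le -D$. The penalty $P_{G,w}(s)\in[0,\infty]$ is the supremum of all such $D$, and $P(G,w)=\min_s P_{G,w}(s)$. **Lemma.** There is an algorithm (one fixed word-RAM program) that takes as input a weighted graph $(G,w)$ given by its list of edges (in any order), a rational number $D\ge 0$ with $D\le P(G,w)$ (given as a fraction $p/q$ of natural numbers, $q>0$), and an upper bound $M$ on the finite minimal energies of $(G,w)$, and that computes the minimal energies $e^*_{G,w}(v)$ of all nodes $v$ in time $$O\Big(mn\cdot\max\{0,\log D\}+m\cdot\Big(\frac{M}{\lceil D\rceil}+1\Big)\Big),$$ where $\max\{0,\log D\}$ and $\lceil D\rceil$ are read as $0$ and $1$ for $D=0$. Moreover, whenever $D\ge M/(2n)$, the same algorithm runs in time $$O\big(mn\cdot\max\{1,\log(M/n)\}\big),$$ where the maximum is read as $1$ for $M=0$. The constants in $O(\cdot)$ are absolute. Time is counted in unit-cost operations (integer addition, subtraction, multiplication, division, comparison, memory access, branching) on words of $O(\log N)$ bits, where $N=2+n+m+W+M+p+q$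 and $W=\max_{(u,v)\in E}|w(u,v)|$. -/

import Mathlib

open scoped NNReal ENNReal

noncomputable section

/-! ## Energy games -/

/-- A finite game graph: a directed graph in which every node has out-degree at least one, with the
nodes partitioned into Alice's nodes `VA` and Bob's nodes (the complement of `VA`).  Self-loops are
allowed. -/
structure GameGraph (V : Type) where
  E : Finset (V × V)
  VA : Finset V
  exists_out : ∀ u, ∃ v, (u, v) ∈ E

namespace GameGraph

variable {V : Type} (G : GameGraph V)

/-- Positional strategies of Alice. -/
def AliceStrategy : Type := (u : {u // u ∈ G.VA}) → {v // (u.1, v) ∈ G.E}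

/-- Positional strategies of Bob. -/
def BobStrategy : Type := (u : {u // u ∉ G.VA}) → {v // (u.1, v) ∈ G.E}

open Classical in
/-- The unique out-neighbour of `u` in the restriction of the graph to a pair of strategies. -/
def next (σ : G.AliceStrategy) (τ : G.BobStrategy) (u : V) : V :=
  if h : u ∈ G.VA then (σ ⟨u, h⟩).1 else (τ ⟨u, h⟩).1

/-- The node that is reached from `s` after `i` rounds. -/
def play (σ : G.AliceStrategy) (τ : G.BobStrategy) (s : V) (i : ℕ) : V :=
  (G.next σ τ)^[i] s

/-- The total weight of the path that consists of the first `i` edges of the play from `s`. -/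
def pathWeight (w : V → V → ℤ) (σ : G.AliceStrategy) (τ : G.BobStrategy) (s : V) (i : ℕ) : ℤ :=
  ∑ j ∈ Finset.range i, w (G.play σ τ s j) (G.play σ τ s (j + 1))

variable [Fintype V]

open Classical in
/-- The nodes of the unique cycle reachable from `s` when both strategies are fixed.  The edges of
that cycle are `(u, next u)` for its nodes `u`. -/
def cycle (σ : G.AliceStrategy) (τ : G.BobStrategy) (s : V) : Finset V :=
  Finset.univ.filter fun u => u ∈ Function.periodicPts (G.next σ τ) ∧ ∃ i, G.play σ τ s i = u

/-- The total weight of the cycle reachable from `s`. -/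
def cycleWeight (w : V → V → ℤ) (σ : G.AliceStrategy) (τ : G.BobStrategy) (s : V) : ℤ :=
  ∑ u ∈ G.cycle σ τ s, w u (G.next σ τ u)

open Classical in
/-- The minimal sufficient energy at `s` for a pair of strategies: it is infinite if the reachable
cycle is negative, and otherwise it is the maximum of `0` and of `- w(P)` over the simple paths `P`
from `s` (`Int.toNat z` is `max 0 z`). -/
def pairEnergy (w : V → V → ℤ) (σ : G.AliceStrategy) (τ : G.BobStrategy) (s : V) : ℕ∞ :=
  if G.cycleWeight w σ τ s < 0 then ⊤
  else ⨆ (i : ℕ) (_ : Set.InjOn (G.play σ τ s) (Set.Iic i)),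
    ((-(G.pathWeight w σ τ s i)).toNat : ℕ∞)

/-- The minimal energy at `s`: the minimum over Alice's strategies of the maximum over Bob's
strategies of the energy for the pair (there are finitely many strategies). -/
def minEnergy (w : V → V → ℤ) (s : V) : ℕ∞ :=
  ⨅ σ : G.AliceStrategy, ⨆ τ : G.BobStrategy, G.pairEnergy w σ τ s

/-- `M` is an upper bound on the finite minimal energies. -/
def IsEnergyBound (w : V → V → ℤ) (M : ℕ) : Prop :=
  ∀ v, G.minEnergy w v = ⊤ ∨ G.minEnergy w v ≤ (M : ℕ∞)

/-- Bob's strategy `τ` is optimal for the game that starts at `s`. -/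
def IsOptimalBob (w : V → V → ℤ) (τ : G.BobStrategy) (s : V) : Prop :=
  ∀ σ : G.AliceStrategy, G.minEnergy w s ≤ G.pairEnergy w σ τ s

/-- The node `s` has a penalty of at least `D`. -/
def HasPenaltyAtLeast (w : V → V → ℤ) (s : V) (D : ℝ≥0) : Prop :=
  ∃ τ : G.BobStrategy, G.IsOptimalBob w τ s ∧ ∀ σ : G.AliceStrategy,
    G.cycleWeight w σ τ s < 0 →
      (G.cycleWeight w σ τ s : ℝ) / ((G.cycle σ τ s).card : ℝ) ≤ -(D : ℝ)

/-- The penalty of the node `s`, possibly infinite. -/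
def nodePenalty (w : V → V → ℤ) (s : V) : ℝ≥0∞ :=
  ⨆ (D : ℝ≥0) (_ : G.HasPenaltyAtLeast w s D), (D : ℝ≥0∞)

/-- The penalty of the weighted graph: the minimum of the penalties of its nodes. -/
def penalty (w : V → V → ℤ) : ℝ≥0∞ :=
  ⨅ s : V, G.nodePenalty w s

end GameGraph

/-! ## Random access machines

A program is a finite text over finitely many integer registers and finitely many integer arrays.
The machine is a word RAM: each arithmetic operation, comparison, memory access and branch takes one
unit of time, and every number that is computed has to fit into a machine word. -/

namespace WordRAM

/-- Operations of unit cost.  `div` is integer division with rounding down for positive divisors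
(and `x / 0 = 0`), and the comparisons return `1` for true and `0` for false. -/
inductive Op where
  | add | sub | mul | div | lt | eq

def Op.eval : Op → ℤ → ℤ → ℤ
  | .add, x, y => x + y
  | .sub, x, y => x - y
  | .mul, x, y => x * y
  | .div, x, y => x / y
  | .lt, x, y => if x < y then 1 else 0
  | .eq, x, y => if x = y then 1 else 0

/-- Expressions: constants, registers, array reads (`read a e` is the cell of array `a` with the
index `e`), and operations. -/
inductive Expr where
  | const (z : ℤ)
  | reg (x : ℕ)
  | read (a : ℕ) (e : Expr)
  | op (o : Op) (e₁ e₂ : Expr)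

/-- Programs. -/
inductive Prog where
  | skip
  | assign (x : ℕ) (e : Expr)
  | write (a : ℕ) (i e : Expr)
  | seq (P Q : Prog)
  | ite (b : Expr) (P Q : Prog)
  | while (b : Expr) (P : Prog)

/-- The contents of the registers and of the arrays. -/
structure State where
  reg : ℕ → ℤ
  arr : ℕ → ℕ → ℤ

def State.setReg (s : State) (x : ℕ) (z : ℤ) : State :=
  { s with reg := Function.update s.reg x z }

def State.setArr (s : State) (a i : ℕ) (z : ℤ) : State :=
  { s with arr := Function.update s.arr a (Function.update (s.arr a) i z) }

namespace Expr

def eval (s : State) : Expr → ℤ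
  | const z => z
  | reg x => s.reg x
  | read a e => s.arr a (eval s e).toNat
  | op o e₁ e₂ => o.eval (eval s e₁) (eval s e₂)

/-- The evaluation is legal for words of absolute value at most `β`: all values that occur in it
have absolute value at most `β`, and array indices are nonnegative. -/
def Legal (β : ℕ) (s : State) : Expr → Prop
  | const z => z.natAbs ≤ β
  | reg x => (s.reg x).natAbs ≤ β
  | read a e => Legal β s e ∧ 0 ≤ eval s e ∧ (eval s (read a e)).natAbs ≤ β
  | op o e₁ e₂ => Legal β s e₁ ∧ Legal β s e₂ ∧ (eval s (op o e₁ e₂)).natAbs ≤ β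

/-- The evaluation time: the number of constants, registers, reads and operations. -/
def cost : Expr → ℕ
  | const _ => 1
  | reg _ => 1
  | read _ e => cost e + 1
  | op _ e₁ e₂ => cost e₁ + cost e₂ + 1

end Expr

/-- `Exec β P s t s'`: on a machine whose words hold the integers of absolute value at most `β`,
the program `P`, started in state `s`, halts after exactly `t` units of time in state `s'`, without
any illegal evaluation. -/
inductive Exec (β : ℕ) : Prog → State → ℕ → State → Prop where
  | skip (s : State) : Exec β .skip s 1 s
  | assign (s : State) (x : ℕ) (e : Expr) (he : e.Legal β s) :
      Exec β (.assign x e) s (e.cost + 1) (s.setReg x (e.eval s))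
  | write (s : State) (a : ℕ) (i e : Expr) (hi : i.Legal β s) (hi₀ : 0 ≤ i.eval s)
      (he : e.Legal β s) :
      Exec β (.write a i e) s (i.cost + e.cost + 1) (s.setArr a (i.eval s).toNat (e.eval s))
  | seq {P Q : Prog} {s s' s'' : State} {t t' : ℕ} (hP : Exec β P s t s')
      (hQ : Exec β Q s' t' s'') : Exec β (.seq P Q) s (t + t') s''
  | iteTrue {b : Expr} {P Q : Prog} {s s' : State} {t : ℕ} (hb : b.Legal β s)
      (hb₁ : b.eval s ≠ 0) (hP : Exec β P s t s') : Exec β (.ite b P Q) s (b.cost + 1 + t) s'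
  | iteFalse {b : Expr} {P Q : Prog} {s s' : State} {t : ℕ} (hb : b.Legal β s)
      (hb₀ : b.eval s = 0) (hQ : Exec β Q s t s') : Exec β (.ite b P Q) s (b.cost + 1 + t) s'
  | whileTrue {b : Expr} {P : Prog} {s s' s'' : State} {t t' : ℕ} (hb : b.Legal β s)
      (hb₁ : b.eval s ≠ 0) (hP : Exec β P s t s') (hW : Exec β (.while b P) s' t' s'') :
      Exec β (.while b P) s (b.cost + 1 + t + t') s''
  | whileFalse {b : Expr} {P : Prog} {s : State} (hb : b.Legal β s) (hb₀ : b.eval s = 0) :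
      Exec β (.while b P) s (b.cost + 1) s

end WordRAM

/-! ## Input and output of the algorithm -/

/-- The maximum absolute edge weight. -/
def GameGraph.maxWeight {V : Type} (G : GameGraph V) (w : V → V → ℤ) : ℕ :=
  G.E.sup fun e => (w e.1 e.2).natAbs

open Classical in
/-- The initial memory for a weighted graph on the nodes `0, …, n - 1`, whose edges are listed in
`L`, for the number `M` and the rational number `p / q`.
Registers `0, …, 4` hold `n`, the number of edges, `M`, `p` and `q`.
Cell `v` of array `0` is `1` if `v` is a node of Alice.
Cell `i` of the arrays `1`, `2`, `3` holds the tail, the head and the weight of the `i`-th edge.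
Everything else is `0`. -/
def inputState {n : ℕ} (G : GameGraph (Fin n)) (w : Fin n → Fin n → ℤ) (L : List (Fin n × Fin n))
    (M p q : ℕ) : WordRAM.State where
  reg
    | 0 => n
    | 1 => L.length
    | 2 => M
    | 3 => p
    | 4 => q
    | _ => 0
  arr
    | 0, v => if ∃ u ∈ G.VA, u.val = v then 1 else 0
    | 1, i => if h : i < L.length then ((L[i].1 : ℕ) : ℤ) else 0
    | 2, i => if h : i < L.length then ((L[i].2 : ℕ) : ℤ) else 0
    | 3, i => if h : i < L.length then w L[i].1 L[i].2 else 0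
    | _, _ => 0

/-- An energy as a word of output; `-1` stands for infinity. -/
def encodeEnergy (e : ℕ∞) : ℤ :=
  if e = ⊤ then -1 else (e.toNat : ℤ)

/-- The output of a computation, in array `4`, is the given energy function. -/
def OutputsEnergy {n : ℕ} (s : WordRAM.State) (e : Fin n → ℕ∞) : Prop :=
  ∀ v : Fin n, s.arr 4 v = encodeEnergy (e v)

end

open scoped NNReal ENNReal

noncomputable section

namespace GameGraph

variable {V : Type} (G : GameGraph V)

/-! ## Plays and their cycles -/

/-! The algorithm is scaling on top of value iteration.

Rounding. For a unit `B`, let `E_B` be the minimal energies for the weights `⌈w / B⌉`. Rounding up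
favours Alice, so `E_B` is at most `M / B` wherever the true energy is finite (`minEnergy_le_div`).
Conversely, let `B` be at most the penalty. Play an optimal strategy of Alice for the rounded
weights against an optimal strategy of Bob whose negative cycles have mean weight below `-(B - 1)`.
The rounding errors are integers below `B`, so a cycle that is nonnegative after rounding has true
mean at least `-(B - 1)` and cannot be negative. A simple path loses at most `n * B`. Hence the true
energy is at most `B * (E_B + n)` (`minEnergy_le_mul_add`). For admissible `2 * B` this gives `2 *
E_{2B} ≤ E_B ≤ 2 * (E_{2B} + n)` (`energies_ofGame`).

Value iteration. The minimal energies are the least progress measure (`minEnergy_edgeSat_bob`,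
`minEnergy_edgeSat_alice`, `minEnergy_le_of_edgeSat`). Started below it, raising the value of a
violated node by one never overshoots, and the process can only stop at the minimal energies. The
in-edges of raised nodes wait on a stack, and each node of Alice keeps one candidate edge. A
potential shows that raising `u` costs `O(deg u)` amortized, so a phase in which no value rises by
more than `r` takes `O((r + 1) * m)` steps (`potential_start_le`, `runs_phase`).

Scaling. The first unit is `2 ^ J`, doubled from one as long as it stays at most `D` and `2 ^ J * (2
* n) ≤ M`. The first phase has `r = M / 2 ^ J + 1`. Each of the `J` halvings doubles the known
energies and has `r = 2 * n`. If `D` stopped the doubling, then `M / 2 ^ J` is `O(M / ⌈D⌉)`; if `M`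
did, it is `O(n)` (`time_le_first`, `time_le_second`).

Machine. Loop bodies are verified by weakest preconditions, loops by invariants with potentials. The
invariants bound all stored numbers by one `K`, polynomial in the input, and intermediate results by
a fixed power of `K`. -/

lemma next_mem (σ : G.AliceStrategy) (τ : G.BobStrategy) (u : V) : (u, G.next σ τ u) ∈ G.E := by
  unfold next
  split_ifs with h
  · exact (σ ⟨u, h⟩).2
  · exact (τ ⟨u, h⟩).2

lemma play_succ (σ : G.AliceStrategy) (τ : G.BobStrategy) (s : V) (i : ℕ) :
    G.play σ τ s (i + 1) = G.next σ τ (G.play σ τ s i) :=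
  Function.iterate_succ_apply' _ _ _

lemma play_add (σ : G.AliceStrategy) (τ : G.BobStrategy) (s : V) (i j : ℕ) :
    G.play σ τ s (i + j) = G.play σ τ (G.play σ τ s i) j := by
  unfold play
  rw [add_comm, Function.iterate_add_apply]

lemma pathWeight_succ (w : V → V → ℤ) (σ : G.AliceStrategy) (τ : G.BobStrategy) (s : V) (i : ℕ) :
    G.pathWeight w σ τ s (i + 1) =
      G.pathWeight w σ τ s i + w (G.play σ τ s i) (G.play σ τ s (i + 1)) :=
  Finset.sum_range_succ _ _

/-- Every play runs through a simple path and then closes its first cycle. -/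
lemma exists_lasso [Finite V] (p : ℕ → V) :
    ∃ i c, 0 < c ∧ p (i + c) = p i ∧ Set.InjOn p (Set.Iio (i + c)) := by
  classical
  have hex : ∃ j, ∃ i < j, p i = p j := by
    obtain ⟨a, b, hab, h⟩ := Finite.exists_ne_map_eq_of_infinite p
    rcases lt_or_gt_of_ne hab with h' | h'
    · exact ⟨b, a, h', h⟩
    · exact ⟨a, b, h', h.symm⟩
  obtain ⟨i, hi, hp⟩ := Nat.find_spec hex
  refine ⟨i, Nat.find hex - i, by omega, ?_, ?_⟩
  · rw [Nat.add_sub_cancel' hi.le, hp]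
  · rw [Nat.add_sub_cancel' hi.le]
    intro a ha b hb hab
    by_contra hne
    rcases lt_or_gt_of_ne hne with h' | h'
    · exact Nat.find_min hex hb ⟨a, h', hab⟩
    · exact Nat.find_min hex ha ⟨b, h', hab.symm⟩

lemma play_period (σ : G.AliceStrategy) (τ : G.BobStrategy) {s : V} {i c : ℕ}
    (h : G.play σ τ s (i + c) = G.play σ τ s i) (y : ℕ) :
    G.play σ τ s (i + y + c) = G.play σ τ s (i + y) := by
  rw [show i + y + c = (i + c) + y by ring, play_add, h, ← play_add]

lemma play_mod (σ : G.AliceStrategy) (τ : G.BobStrategy) {s : V} {i c : ℕ}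
    (h : G.play σ τ s (i + c) = G.play σ τ s i) (y : ℕ) :
    G.play σ τ s (i + y) = G.play σ τ s (i + y % c) := by
  conv_lhs => rw [← Nat.mod_add_div y c]
  induction y / c with
  | zero => simp
  | succ k ih =>
    rw [← ih, show i + (y % c + c * (k + 1)) = i + (y % c + c * k) + c by ring, play_period G σ τ h]

instance : Nonempty G.AliceStrategy :=
  ⟨fun u => ⟨_, (G.exists_out u.1).choose_spec⟩⟩

instance : Nonempty G.BobStrategy :=
  ⟨fun u => ⟨_, (G.exists_out u.1).choose_spec⟩⟩

/-- The edge from `u` to `v` exists and respects Alice's strategy. -/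
def Allowed (σ : G.AliceStrategy) (u v : V) : Prop :=
  (u, v) ∈ G.E ∧ ∀ h : u ∈ G.VA, v = (σ ⟨u, h⟩).1

lemma allowed_next (σ : G.AliceStrategy) (τ : G.BobStrategy) (u : V) :
    G.Allowed σ u (G.next σ τ u) :=
  ⟨G.next_mem σ τ u, fun h => by rw [next, dif_pos h]⟩

/-- A walk that respects Alice's strategy and has distinct inner nodes is a prefix of a play. -/
lemma exists_bob_follow (σ : G.AliceStrategy) (p : ℕ → V) (k : ℕ)
    (hE : ∀ i < k, G.Allowed σ (p i) (p (i + 1))) (hinj : Set.InjOn p (Set.Iio k)) :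
    ∃ τ, ∀ i ≤ k, G.play σ τ (p 0) i = p i := by
  classical
  -- The inner nodes are distinct, so the walk asks for at most one successor at each node of Bob.
  have key : ∀ u : {u // u ∉ G.VA}, ∃ v : {v // (u.1, v) ∈ G.E}, ∀ i < k, p i = u → p (i + 1) = v := by
    intro u
    by_cases hu : ∃ i < k, p i = u
    · obtain ⟨i, hi, hpi⟩ := hu
      refine ⟨⟨p (i + 1), hpi ▸ (hE i hi).1⟩, fun j hj hpj => ?_⟩
      rw [hinj (Set.mem_Iio.2 hj) (Set.mem_Iio.2 hi) (hpj.trans hpi.symm)]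
    · push Not at hu
      exact ⟨⟨_, (G.exists_out u.1).choose_spec⟩, fun i hi h => (hu i hi h).elim⟩
  choose τ' hτ using key
  let τ : G.BobStrategy := τ'
  refine ⟨τ, fun i => ?_⟩
  induction i with
  | zero => intro _; rfl
  | succ i ih =>
    intro hi
    rw [play_succ, ih (by omega)]
    by_cases hA : p i ∈ G.VA
    · rw [next, dif_pos hA, (hE i (by omega)).2 hA]
    · rw [next, dif_neg hA]
      exact (hτ ⟨p i, hA⟩ i (by omega) rfl).symm

/-- The energy function `f` is consistent along the edge from `u` to `v` of weight `z`. -/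
def EdgeSat (f : V → ℕ∞) (u v : V) (z : ℤ) : Prop :=
  f u = ⊤ ∨ ∃ a b : ℕ, f u = a ∧ f v = b ∧ (b : ℤ) ≤ a + z

lemma edgeSat_of_le {f : V → ℕ∞} {u v : V} {z : ℤ} {a b : ℕ} (hu : f u = a) (hv : f v ≤ b)
    (h : (b : ℤ) ≤ a + z) : EdgeSat f u v z := by
  obtain ⟨c, hc⟩ := ENat.ne_top_iff_exists.1 (ne_top_of_le_ne_top (ENat.natCast_ne_top b) hv)
  refine Or.inr ⟨a, c, hu, hc.symm, ?_⟩
  rw [← hc] at hv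
  have : c ≤ b := by exact_mod_cast hv
  omega

variable [Fintype V]

open Classical in
lemma cycle_eq_image (σ : G.AliceStrategy) (τ : G.BobStrategy) {s : V} {i c : ℕ} (hc : 0 < c)
    (h : G.play σ τ s (i + c) = G.play σ τ s i) :
    G.cycle σ τ s = (Finset.Ico i (i + c)).image (G.play σ τ s) := by
  ext u
  simp only [cycle, Finset.mem_filter, Finset.mem_univ, true_and, Finset.mem_image, Finset.mem_Ico]
  constructor
  · rintro ⟨⟨t, ht, hper⟩, k, rfl⟩
    -- A node of period `t` recurs at time `k + t * i ≥ i`, where the play has entered its cycle.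
    have hk : G.play σ τ s (k + t * i) = G.play σ τ s k := by
      rw [play_add]
      exact (hper.mul_const i)
    have hle : i ≤ k + t * i := le_trans (Nat.le_mul_of_pos_left i ht) (Nat.le_add_left _ _)
    refine ⟨i + (k + t * i - i) % c, ⟨by omega, by have := Nat.mod_lt (k + t * i - i) hc; omega⟩, ?_⟩
    rw [← play_mod G σ τ h, Nat.add_sub_cancel' hle, hk]
  · rintro ⟨k, ⟨hk, -⟩, rfl⟩
    refine ⟨⟨c, hc, ?_⟩, k, rfl⟩
    have := play_period G σ τ h (k - i)
    rw [Nat.add_sub_cancel' hk, play_add] at this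
    exact this

lemma cycleWeight_eq_sub (w : V → V → ℤ) (σ : G.AliceStrategy) (τ : G.BobStrategy) {s : V}
    {i c : ℕ} (hc : 0 < c) (h : G.play σ τ s (i + c) = G.play σ τ s i)
    (hinj : Set.InjOn (G.play σ τ s) (Set.Iio (i + c))) :
    G.cycleWeight w σ τ s = G.pathWeight w σ τ s (i + c) - G.pathWeight w σ τ s i := by
  classical
  rw [cycleWeight, cycle_eq_image G σ τ hc h, Finset.sum_image]
  · simp only [← play_succ, pathWeight]
    rw [Finset.sum_Ico_eq_sub _ (Nat.le_add_right i c)]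
  · intro a ha b hb hab
    simp only [Finset.coe_Ico, Set.mem_Ico] at ha hb
    exact hinj ha.2 hb.2 hab

/-- `next` permutes the cycle. Along the play this shifts the summation range by one, and both end
terms agree. -/
lemma cycle_next_sum (a : V → ℤ) (σ : G.AliceStrategy) (τ : G.BobStrategy) (s : V) :
    ∑ u ∈ G.cycle σ τ s, a (G.next σ τ u) = ∑ u ∈ G.cycle σ τ s, a u := by
  classical
  obtain ⟨i, c, hc, h, hinj⟩ := exists_lasso (G.play σ τ s)
  rw [cycle_eq_image G σ τ hc h]
  have hinj' : Set.InjOn (G.play σ τ s) (Finset.Ico i (i + c)) := by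
    intro x hx y hy hxy
    simp only [Finset.coe_Ico, Set.mem_Ico] at hx hy
    exact hinj hx.2 hy.2 hxy
  rw [Finset.sum_image hinj', Finset.sum_image hinj']
  simp only [← play_succ]
  rw [Finset.sum_Ico_add' (fun j => a (G.play σ τ s j)) i (i + c) 1,
    Finset.sum_Ico_eq_sub _ (by omega), Finset.sum_Ico_eq_sub _ (by omega),
    Finset.sum_range_succ, Finset.sum_range_succ, h]
  ring

/-! ## Energies of strategy pairs -/

lemma pairEnergy_le_coe_iff (w : V → V → ℤ) (σ : G.AliceStrategy) (τ : G.BobStrategy) (s : V)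
    (x : ℕ) :
    G.pairEnergy w σ τ s ≤ x ↔ 0 ≤ G.cycleWeight w σ τ s ∧
      ∀ i, Set.InjOn (G.play σ τ s) (Set.Iic i) → -(G.pathWeight w σ τ s i) ≤ x := by
  unfold pairEnergy
  split_ifs with h
  · simp [h]
  · simp only [iSup_le_iff, Nat.cast_le, Int.toNat_le, not_lt.mp h, true_and]

lemma minEnergy_le_coe_iff (w : V → V → ℤ) (s : V) (x : ℕ) :
    G.minEnergy w s ≤ x ↔ ∃ σ, ∀ τ, G.pairEnergy w σ τ s ≤ x := by
  constructor
  · intro h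
    -- The infimum is attained because `ℕ∞` is well ordered.
    obtain ⟨σ, hσ⟩ := ciInf_mem fun σ : G.AliceStrategy => ⨆ τ, G.pairEnergy w σ τ s
    refine ⟨σ, fun τ => (le_iSup (fun τ => G.pairEnergy w σ τ s) τ).trans ?_⟩
    exact hσ.le.trans h
  · rintro ⟨σ, h⟩
    exact (iInf_le _ σ).trans (iSup_le h)

/-- If Alice's strategy guarantees the energy `x`, then it does so along every walk. -/
lemma neg_walk_weight_le (w : V → V → ℤ) (σ : G.AliceStrategy) (s : V) (x : ℕ)
    (hx : ∀ τ, G.pairEnergy w σ τ s ≤ x) (k : ℕ) :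
    ∀ p : ℕ → V, p 0 = s → (∀ i < k, G.Allowed σ (p i) (p (i + 1))) →
      -(∑ i ∈ Finset.range k, w (p i) (p (i + 1))) ≤ x := by
  induction k using Nat.strong_induction_on with
  | _ k ih =>
    intro p h0 hE
    obtain ⟨i, c, hc, hp, hinj⟩ := exists_lasso p
    -- Before its first cycle closes, the walk is a simple path of a play. Afterwards that cycle has
    -- nonnegative weight, and cutting it out leaves a shorter walk that weighs no more.
    by_cases hk : k < i + c
    · obtain ⟨τ, hτ⟩ := G.exists_bob_follow σ p k hE
        (hinj.mono fun a ha => lt_trans (Set.mem_Iio.1 ha) hk)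
      rw [h0] at hτ
      have h1 := ((G.pairEnergy_le_coe_iff w σ τ s x).1 (hx τ)).2 k ?_
      · refine le_trans (le_of_eq ?_) h1
        rw [pathWeight]
        refine congrArg _ (Finset.sum_congr rfl fun j hj => ?_)
        rw [Finset.mem_range] at hj
        rw [hτ j hj.le, hτ (j + 1) hj]
      · intro a ha b hb hab
        rw [hτ a ha, hτ b hb] at hab
        exact hinj (lt_of_le_of_lt ha hk) (lt_of_le_of_lt hb hk) hab
    · push Not at hk
      obtain ⟨τ, hτ⟩ := G.exists_bob_follow σ p (i + c) (fun j hj => hE j (by omega)) hinj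
      rw [h0] at hτ
      have hcyc := ((G.pairEnergy_le_coe_iff w σ τ s x).1 (hx τ)).1
      have hpw : ∀ j ≤ i + c, G.pathWeight w σ τ s j = ∑ l ∈ Finset.range j, w (p l) (p (l + 1)) := by
        intro j hj
        rw [pathWeight]
        refine Finset.sum_congr rfl fun l hl => ?_
        rw [Finset.mem_range] at hl
        rw [hτ l (by omega), hτ (l + 1) (by omega)]
      rw [G.cycleWeight_eq_sub w σ τ hc (by rw [hτ _ le_rfl, hτ _ (by omega), hp])
        (fun a ha b hb hab => hinj ha hb (by
          rwa [hτ a (le_of_lt ha), hτ b (le_of_lt hb)] at hab)), hpw _ le_rfl, hpw i (by omega)] at hcyc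
      have hcut := ih (k - c) (by omega) (fun t => if t < i then p t else p (t + c)) ?_ ?_
      · have hsum : ∑ t ∈ Finset.range (k - c), w (if t < i then p t else p (t + c))
            (if t + 1 < i then p (t + 1) else p (t + 1 + c)) =
            ∑ t ∈ Finset.range i, w (p t) (p (t + 1)) +
              ∑ t ∈ Finset.Ico (i + c) k, w (p t) (p (t + 1)) := by
          rw [← Finset.sum_range_add_sum_Ico _ (show i ≤ k - c by omega)]
          congr 1
          · refine Finset.sum_congr rfl fun t ht => ?_
            rw [Finset.mem_range] at ht
            rw [if_pos ht]
            split_ifs with h'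
            · rfl
            · rw [show t + 1 = i by omega, hp]
          · rw [show k = k - c + c by omega,
              ← Finset.sum_Ico_add' (fun t => w (p t) (p (t + 1))) i (k - c) c]
            simp only [Nat.add_sub_cancel]
            refine Finset.sum_congr rfl fun t ht => ?_
            rw [Finset.mem_Ico] at ht
            rw [if_neg (by omega), if_neg (by omega), show t + 1 + c = t + c + 1 by ring]
        have hsum' := Finset.sum_range_add_sum_Ico (fun t => w (p t) (p (t + 1))) hk
        rw [hsum] at hcut
        linarith
      · split_ifs with h'
        · exact h0
        · rw [show i = 0 by omega] at hp
          rw [hp, h0]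
      · intro t ht
        split_ifs with h1 h2 h2
        · exact hE t (by omega)
        · rw [show t + 1 = i by omega, hp, ← show t + 1 = i by omega]
          exact hE t (by omega)
        · omega
        · rw [show t + 1 + c = t + c + 1 by ring]
          exact hE _ (by omega)

/-! ## Progress measures -/

/-- The strategy that is good at `u` is also good at `v`: the edge followed by any play from `v` is
a walk from `u`, which bounds all path weights from `v`. A negative cycle would break this bound
when traversed often enough. -/
lemma edgeSat_of_guarantee (w : V → V → ℤ) {σ : G.AliceStrategy} {u v : V} {x : ℕ}
    (hx : ∀ τ, G.pairEnergy w σ τ u ≤ x) (huv : G.Allowed σ u v) :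
    ∃ b : ℕ, G.minEnergy w v ≤ b ∧ (b : ℤ) ≤ x + w u v := by
  have hwalk : ∀ τ i, -(w u v + G.pathWeight w σ τ v i) ≤ x := by
    intro τ i
    have := G.neg_walk_weight_le w σ u x hx (i + 1)
      (fun t => Nat.casesOn t u (fun t => G.play σ τ v t)) rfl ?_
    · rw [Finset.sum_range_succ'] at this
      rw [add_comm (w u v)]
      exact this
    · rintro (_ | t) -
      · exact huv
      · change G.Allowed σ (G.play σ τ v t) (G.play σ τ v (t + 1))
        rw [play_succ]
        exact G.allowed_next σ τ _
  have h0 : 0 ≤ (x : ℤ) + w u v := by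
    have := hwalk (Classical.arbitrary _) 0
    simp only [pathWeight, Finset.range_zero, Finset.sum_empty] at this
    linarith
  refine ⟨((x : ℤ) + w u v).toNat, ?_, (Int.toNat_of_nonneg h0).le⟩
  rw [minEnergy_le_coe_iff]
  refine ⟨σ, fun τ => ?_⟩
  rw [pairEnergy_le_coe_iff, Int.toNat_of_nonneg h0]
  refine ⟨?_, fun i _ => by linarith [hwalk τ i]⟩
  obtain ⟨i, c, hc, h, hinj⟩ := exists_lasso (G.play σ τ v)
  by_contra hneg
  push Not at hneg
  have hiter : ∀ t : ℕ, G.pathWeight w σ τ v (i + c * t) =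
      G.pathWeight w σ τ v i + t * G.cycleWeight w σ τ v := by
    intro t
    induction t with
    | zero => simp
    | succ t ih =>
      have hshift : ∀ y, G.pathWeight w σ τ v (i + y + c) - G.pathWeight w σ τ v (i + y) =
          G.pathWeight w σ τ v (i + c) - G.pathWeight w σ τ v i := by
        intro y
        induction y with
        | zero => rfl
        | succ y ihy =>
          rw [← ihy, show i + (y + 1) + c = i + y + c + 1 by ring, ← add_assoc i y 1,
            pathWeight_succ, pathWeight_succ, play_period G σ τ h,
            show i + y + c + 1 = i + (y + 1) + c by ring, play_period G σ τ h]
          ring_nf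
      have h2 := hshift (c * t)
      rw [← G.cycleWeight_eq_sub w σ τ hc h hinj, ih] at h2
      rw [show i + c * (t + 1) = i + c * t + c by ring]
      push_cast
      linarith
  -- Each round of a negative cycle loses at least one, so this many rounds exceed everything that
  -- `x`, the edge and the path to the cycle can compensate.
  have h3 := hwalk τ (i + c * (x + (w u v).natAbs + (G.pathWeight w σ τ v i).natAbs + 1))
  rw [hiter] at h3
  push_cast at h3
  have h4 : ((x : ℤ) + |w u v| + |G.pathWeight w σ τ v i| + 1) * G.cycleWeight w σ τ v ≤
      ((x : ℤ) + |w u v| + |G.pathWeight w σ τ v i| + 1) * (-1) :=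
    mul_le_mul_of_nonneg_left (by omega) (by positivity)
  have h5 := le_abs_self (w u v)
  have h6 := le_abs_self (G.pathWeight w σ τ v i)
  linarith

lemma minEnergy_edgeSat_bob (w : V → V → ℤ) {u v : V} (hu : u ∉ G.VA) (huv : (u, v) ∈ G.E) :
    EdgeSat (G.minEnergy w) u v (w u v) := by
  by_cases htop : G.minEnergy w u = ⊤
  · exact Or.inl htop
  obtain ⟨a, ha⟩ := ENat.ne_top_iff_exists.1 htop
  obtain ⟨σ, hσ⟩ := (G.minEnergy_le_coe_iff w u a).1 ha.symm.le
  obtain ⟨b, hb, hb'⟩ := G.edgeSat_of_guarantee w hσ ⟨huv, fun h => (hu h).elim⟩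
  exact edgeSat_of_le ha.symm hb hb'

lemma minEnergy_edgeSat_alice (w : V → V → ℤ) {u : V} (hu : u ∈ G.VA) :
    ∃ v, (u, v) ∈ G.E ∧ EdgeSat (G.minEnergy w) u v (w u v) := by
  by_cases htop : G.minEnergy w u = ⊤
  · obtain ⟨v, hv⟩ := G.exists_out u
    exact ⟨v, hv, Or.inl htop⟩
  obtain ⟨a, ha⟩ := ENat.ne_top_iff_exists.1 htop
  obtain ⟨σ, hσ⟩ := (G.minEnergy_le_coe_iff w u a).1 ha.symm.le
  obtain ⟨b, hb, hb'⟩ := G.edgeSat_of_guarantee w hσ ⟨(σ ⟨u, hu⟩).2, fun _ => rfl⟩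
  exact ⟨_, (σ ⟨u, hu⟩).2, edgeSat_of_le ha.symm hb hb'⟩

/-- The minimal energies are below every progress measure. -/
lemma minEnergy_le_of_edgeSat (w : V → V → ℤ) (f : V → ℕ∞)
    (hB : ∀ u v, u ∉ G.VA → (u, v) ∈ G.E → EdgeSat f u v (w u v))
    (hA : ∀ u ∈ G.VA, ∃ v, (u, v) ∈ G.E ∧ EdgeSat f u v (w u v)) (s : V) :
    G.minEnergy w s ≤ f s := by
  by_cases htop : f s = ⊤
  · rw [htop]; exact le_top
  obtain ⟨x, hx⟩ := ENat.ne_top_iff_exists.1 htop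
  rw [← hx, minEnergy_le_coe_iff]
  -- Alice always takes a consistent edge; then `f` decreases along the play by at least the energy
  -- lost.
  choose! v hvE hv using hA
  refine ⟨fun u => ⟨v u, hvE u u.2⟩, fun τ => ?_⟩
  set σ : G.AliceStrategy := fun u => ⟨v u, hvE u u.2⟩ with hσ
  have hstep : ∀ u, EdgeSat f u (G.next σ τ u) (w u (G.next σ τ u)) := by
    intro u
    by_cases hu : u ∈ G.VA
    · rw [next, dif_pos hu]; exact hv u hu
    · exact hB _ _ hu (G.next_mem σ τ u)
  have hfin : ∀ i, f (G.play σ τ s i) ≠ ⊤ := by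
    intro i
    induction i with
    | zero => exact htop
    | succ i ih =>
      rw [play_succ]
      rcases hstep (G.play σ τ s i) with h | ⟨a, b, -, h, -⟩
      · exact (ih h).elim
      · rw [h]; exact ENat.natCast_ne_top b
  have hstep' : ∀ u, f u ≠ ⊤ →
      ((f (G.next σ τ u)).toNat : ℤ) ≤ (f u).toNat + w u (G.next σ τ u) := by
    intro u hu
    rcases hstep u with h | ⟨a, b, ha, hb, hab⟩
    · exact (hu h).elim
    · rw [ha, hb]; exact hab
  rw [pairEnergy_le_coe_iff]
  constructor
  -- Around the cycle the values of `f` cancel, which leaves its weight nonnegative.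
  · have h1 := G.cycle_next_sum (fun u => ((f u).toNat : ℤ)) σ τ s
    have h2 : ∑ u ∈ G.cycle σ τ s, ((f (G.next σ τ u)).toNat : ℤ) ≤
        ∑ u ∈ G.cycle σ τ s, (((f u).toNat : ℤ) + w u (G.next σ τ u)) := by
      refine Finset.sum_le_sum fun u hu => hstep' u ?_
      simp only [cycle, Finset.mem_filter] at hu
      obtain ⟨i, rfl⟩ := hu.2.2
      exact hfin i
    rw [h1, Finset.sum_add_distrib] at h2
    rw [cycleWeight]
    linarith
  · intro i _
    have : ∀ i, ((f (G.play σ τ s i)).toNat : ℤ) ≤ x + G.pathWeight w σ τ s i := by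
      intro i
      induction i with
      | zero =>
        simp only [pathWeight, Finset.range_zero, Finset.sum_empty, add_zero]
        change ((f s).toNat : ℤ) ≤ x
        rw [← hx]; rfl
      | succ i ih =>
        rw [pathWeight_succ, play_succ]
        have := hstep' _ (hfin i)
        linarith
    have := this i
    omega

/-! ## Rounding the weights -/

/-- Multiplying coarser weights by the unit does not increase the energies. -/
lemma minEnergy_le_div (w w' : V → V → ℤ) (B : ℕ) (hB : 0 < B)
    (h : ∀ u v, w u v ≤ B * w' u v) {s : V} {x : ℕ} (hx : G.minEnergy w s ≤ x) :
    G.minEnergy w' s ≤ (x / B : ℕ) := by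
  rw [minEnergy_le_coe_iff] at hx ⊢
  obtain ⟨σ, hσ⟩ := hx
  refine ⟨σ, fun τ => ?_⟩
  have h1 := hσ τ
  rw [pairEnergy_le_coe_iff] at h1 ⊢
  have hB' : (0 : ℤ) < B := by exact_mod_cast hB
  constructor
  · have h2 : G.cycleWeight w σ τ s ≤ B * G.cycleWeight w' σ τ s := by
      rw [cycleWeight, cycleWeight, Finset.mul_sum]
      exact Finset.sum_le_sum fun u _ => h _ _
    exact nonneg_of_mul_nonneg_right (h1.1.trans h2) hB'
  · intro i hi
    have h2 : G.pathWeight w σ τ s i ≤ B * G.pathWeight w' σ τ s i := by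
      rw [pathWeight, pathWeight, Finset.mul_sum]
      exact Finset.sum_le_sum fun u _ => h _ _
    push_cast
    rw [Int.le_ediv_iff_mul_le hB']
    have := h1.2 i hi
    linarith

/-- Under a large penalty, rounding the weights up to multiples of `B` changes the energies by less
than `n B`. -/
lemma minEnergy_le_mul_add (w w' : V → V → ℤ) (B : ℕ) (h : ∀ u v, B * w' u v < w u v + B)
    (hB : 0 < B) (hpen : (B : ℝ≥0∞) ≤ G.penalty w) {s : V} {y : ℕ} (hy : G.minEnergy w' s ≤ y) :
    G.minEnergy w s ≤ (B * (y + Fintype.card V) : ℕ) := by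
  -- The penalty is a supremum, so a strategy is only extracted for some `D > B - 1`. For integer
  -- weights this suffices.
  have hpen' : ((B - 1 : ℕ) : ℝ≥0∞) < G.nodePenalty w s := by
    refine lt_of_lt_of_le ?_ (hpen.trans (iInf_le _ s))
    exact_mod_cast Nat.sub_lt hB one_pos
  simp only [nodePenalty, lt_iSup_iff] at hpen'
  obtain ⟨D, ⟨τ, hopt, hτ⟩, hD⟩ := hpen'
  have hD' : ((B : ℝ) - 1) < D := by
    have h1 : ((B - 1 : ℕ) : ℝ≥0) < D := by exact_mod_cast hD
    have h2 : ((B - 1 : ℕ) : ℝ) < D := by exact_mod_cast h1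
    rwa [Nat.cast_sub hB, Nat.cast_one] at h2
  -- Alice's strategy is good for the rounded weights, Bob's is optimal for the true ones; this pair
  -- compares both games.
  obtain ⟨σ, hσ⟩ := (G.minEnergy_le_coe_iff w' s y).1 hy
  refine (hopt σ).trans ?_
  have h1 := hσ τ
  rw [pairEnergy_le_coe_iff] at h1 ⊢
  constructor
  · by_contra hneg
    push Not at hneg
    have h2 := hτ σ hneg
    have hcard : 0 < (G.cycle σ τ s).card := by
      rw [Finset.card_pos, Finset.nonempty_iff_ne_empty]
      intro h0
      rw [cycleWeight, h0, Finset.sum_empty] at hneg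
      exact lt_irrefl _ hneg
    have hcard' : (0 : ℝ) < (G.cycle σ τ s).card := by exact_mod_cast hcard
    rw [div_le_iff₀ hcard'] at h2
    -- By integrality an edge gains at most `B - 1` by rounding, so the true mean weight is at least
    -- `-(B - 1) > -D`.
    have h3 : B * G.cycleWeight w' σ τ s ≤
        G.cycleWeight w σ τ s + (G.cycle σ τ s).card * (B - 1 : ℤ) := by
      rw [cycleWeight, cycleWeight, Finset.mul_sum, ← nsmul_eq_mul, ← Finset.sum_const,
        ← Finset.sum_add_distrib]
      refine Finset.sum_le_sum fun u _ => ?_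
      have := h u (G.next σ τ u)
      linarith
    have h4 : (0 : ℤ) ≤ B * G.cycleWeight w' σ τ s := mul_nonneg (by positivity) h1.1
    have h5 : (0 : ℝ) ≤ G.cycleWeight w σ τ s + (G.cycle σ τ s).card * ((B : ℝ) - 1) := by
      exact_mod_cast h4.trans h3
    nlinarith
  · intro i hi
    have h2 : B * G.pathWeight w' σ τ s i ≤ G.pathWeight w σ τ s i + i * B := by
      rw [pathWeight, pathWeight, Finset.mul_sum]
      have : (i : ℤ) * B = ∑ _j ∈ Finset.range i, (B : ℤ) := by simp
      rw [this, ← Finset.sum_add_distrib]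
      exact Finset.sum_le_sum fun u _ => (h _ _).le
    have h3 : i ≤ Fintype.card V := by
      have h4 : (Finset.range i).card ≤ (Finset.univ : Finset V).card :=
        Finset.card_le_card_of_injOn (G.play σ τ s) (fun _ _ => Finset.mem_univ _)
          (fun a ha b hb hab => hi (Finset.mem_range.1 ha).le (Finset.mem_range.1 hb).le hab)
      rwa [Finset.card_range] at h4
    have h5 := h1.2 i hi
    have h6 : (i : ℤ) * B ≤ Fintype.card V * B := by
      exact_mod_cast Nat.mul_le_mul_right B h3
    push_cast
    nlinarith

end GameGraph

namespace WordRAM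

/-! ## Reasoning about programs -/

/-- The program halts within `T` units of time in a state that satisfies `Q`. -/
def Runs (β : ℕ) (P : Prog) (s : State) (T : ℕ) (Q : State → Prop) : Prop :=
  ∃ t s', Exec β P s t s' ∧ t ≤ T ∧ Q s'

lemma Runs.mono {β : ℕ} {P : Prog} {s : State} {T T' : ℕ} {Q Q' : State → Prop}
    (h : Runs β P s T Q) (hT : T ≤ T') (hQ : ∀ s', Q s' → Q' s') : Runs β P s T' Q' := by
  obtain ⟨t, s', h1, h2, h3⟩ := h
  exact ⟨t, s', h1, h2.trans hT, hQ _ h3⟩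

lemma Runs.seq {β : ℕ} {P P' : Prog} {s : State} {T T' : ℕ} {Q Q' : State → Prop}
    (h : Runs β P s T Q) (h' : ∀ s', Q s' → Runs β P' s' T' Q') :
    Runs β (.seq P P') s (T + T') Q' := by
  obtain ⟨t, s', h1, h2, h3⟩ := h
  obtain ⟨t', s'', h1', h2', h3'⟩ := h' s' h3
  exact ⟨t + t', s'', .seq h1 h1', add_le_add h2 h2', h3'⟩

/-- A loop whose body decreases the potential `Φ` of an abstraction of the state. -/
lemma Runs.while_of_potential {α : Type*} {β : ℕ} {b : Expr} {P : Prog} (I : α → State → Prop)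
    (Φ : α → ℕ) (c : ℕ) (hb : ∀ a s, I a s → b.Legal β s)
    (hP : ∀ a s, I a s → b.eval s ≠ 0 → Runs β P s c fun s' => ∃ a', I a' s' ∧ Φ a' < Φ a)
    (a : α) (s : State) (h : I a s) :
    Runs β (.while b P) s (Φ a * (c + b.cost + 1) + (b.cost + 1)) fun s' => ∃ a', I a' s' ∧ b.eval s' = 0 := by
  induction hΦ : Φ a using Nat.strong_induction_on generalizing a s with
  | _ N ih =>
    by_cases h0 : b.eval s = 0
    · refine ⟨_, s, .whileFalse (hb a s h) h0, ?_, a, h, h0⟩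
      omega
    · obtain ⟨t, s', h1, h2, a', h3, h4⟩ := hP a s h h0
      obtain ⟨t', s'', h1', h2', h3'⟩ := ih (Φ a') (hΦ ▸ h4) a' s' h3 rfl
      refine ⟨_, s'', .whileTrue (hb a s h) h0 h1 h1', ?_, h3'⟩
      have : (Φ a' + 1) * (c + b.cost + 1) ≤ N * (c + b.cost + 1) :=
        Nat.mul_le_mul_right _ (hΦ ▸ h4)
      nlinarith

/-! ### Sizes of numbers and weakest preconditions -/

/-- All numbers in the memory have absolute value at most `K`. -/
def State.Bdd (K : ℕ) (s : State) : Prop :=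
  (∀ x, (s.reg x).natAbs ≤ K) ∧ ∀ a i, (s.arr a i).natAbs ≤ K

lemma State.Bdd.mono {K K' : ℕ} {s : State} (h : s.Bdd K) (hK : K ≤ K') : s.Bdd K' :=
  ⟨fun x => (h.1 x).trans hK, fun a i => (h.2 a i).trans hK⟩

lemma State.Bdd.setReg {K : ℕ} {s : State} (h : s.Bdd K) (x : ℕ) {z : ℤ} (hz : z.natAbs ≤ K) :
    (s.setReg x z).Bdd K := by
  refine ⟨fun y => ?_, h.2⟩
  simp only [State.setReg, Function.update_apply]
  split_ifs
  exacts [hz, h.1 y]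

lemma State.Bdd.setArr {K : ℕ} {s : State} (h : s.Bdd K) (a i : ℕ) {z : ℤ} (hz : z.natAbs ≤ K) :
    (s.setArr a i z).Bdd K := by
  refine ⟨h.1, fun a' i' => ?_⟩
  simp only [State.setArr, Function.update_apply]
  by_cases h1 : a' = a
  · rw [if_pos h1, Function.update_apply]
    split_ifs
    exacts [hz, h.2 a i']
  · rw [if_neg h1]
    exact h.2 a' i'

/-- All array indices in the evaluation are nonnegative. -/
def Expr.NonnegReads (s : State) : Expr → Prop
  | const _ => True
  | reg _ => True
  | read _ e => NonnegReads s e ∧ 0 ≤ e.eval s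
  | op _ e₁ e₂ => NonnegReads s e₁ ∧ NonnegReads s e₂

/-- All constants have absolute value at most two. -/
def Expr.SmallConsts : Expr → Prop
  | const z => z.natAbs ≤ 2
  | reg _ => True
  | read _ e => SmallConsts e
  | op _ e₁ e₂ => SmallConsts e₁ ∧ SmallConsts e₂

/-- A product bound serves for sums too, so that sizes are tracked by exponents alone. -/
lemma Op.natAbs_eval_le (o : Op) {x y : ℤ} {X Y : ℕ} (hX : 1 ≤ X) (hY : 1 ≤ Y)
    (hx : x.natAbs ≤ X) (hy : y.natAbs ≤ Y) : (o.eval x y).natAbs ≤ 2 * (X * Y) := by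
  have h1 : X ≤ X * Y := Nat.le_mul_of_pos_right _ hY
  have h2 : Y ≤ X * Y := Nat.le_mul_of_pos_left _ hX
  cases o with
  | add => exact (Int.natAbs_add_le x y).trans (by omega)
  | sub => simp only [Op.eval]; omega
  | mul =>
    simp only [Op.eval, Int.natAbs_mul]
    have := Nat.mul_le_mul hx hy
    omega
  | div =>
    have := Int.natAbs_ediv_le_natAbs x y
    simp only [Op.eval]
    omega
  | lt => simp only [Op.eval]; split_ifs <;> simp only [Int.natAbs_one, Int.natAbs_zero] <;> omega
  | eq => simp only [Op.eval]; split_ifs <;> simp only [Int.natAbs_one, Int.natAbs_zero] <;> omega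

lemma Expr.cost_pos (e : Expr) : 0 < e.cost := by
  cases e <;> simp [Expr.cost]

/-- Every leaf contributes one factor `K`, and the factor 2 of an operation is absorbed into one
more; hence the exponent is the cost. -/
lemma Expr.eval_le_and_legal {K : ℕ} (hK : 2 ≤ K) {s : State} (hs : s.Bdd K) (e : Expr)
    (hr : e.NonnegReads s) (hc : e.SmallConsts) :
    (e.eval s).natAbs ≤ K ^ e.cost ∧ ∀ β, K ^ e.cost ≤ β → e.Legal β s := by
  induction e with
  | const z =>
    simp only [Expr.SmallConsts, Expr.eval, Expr.cost, pow_one, Expr.Legal] at *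
    exact ⟨by omega, fun β h => by omega⟩
  | reg x =>
    simp only [Expr.eval, Expr.cost, pow_one, Expr.Legal]
    exact ⟨hs.1 x, fun β h => (hs.1 x).trans h⟩
  | read a e ih =>
    obtain ⟨h1, h2⟩ := ih hr.1 hc
    have h3 : K ≤ K ^ (e.cost + 1) := Nat.le_self_pow (by omega) K
    have h4 : K ^ e.cost ≤ K ^ (e.cost + 1) := Nat.pow_le_pow_right (by omega) (by omega)
    refine ⟨(hs.2 _ _).trans h3, fun β h => ⟨h2 β (h4.trans h), hr.2, ?_⟩⟩
    exact (hs.2 _ _).trans (h3.trans h)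
  | op o e₁ e₂ ih₁ ih₂ =>
    obtain ⟨h1, h2⟩ := ih₁ hr.1 hc.1
    obtain ⟨h1', h2'⟩ := ih₂ hr.2 hc.2
    have h3 := o.natAbs_eval_le (Nat.one_le_pow _ _ (by omega)) (Nat.one_le_pow _ _ (by omega)) h1 h1'
    have h4 : 2 * (K ^ e₁.cost * K ^ e₂.cost) ≤ K ^ (e₁.cost + e₂.cost + 1) := by
      rw [pow_succ, pow_add, mul_comm 2]
      exact Nat.mul_le_mul_left _ hK
    refine ⟨h3.trans h4, fun β h => ⟨h2 β ?_, h2' β ?_, (h3.trans h4).trans h⟩⟩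
    · exact (Nat.pow_le_pow_right (by omega) (by simp [Expr.cost]; omega)).trans h
    · exact (Nat.pow_le_pow_right (by omega) (by simp [Expr.cost]; omega)).trans h

namespace Prog

/-- Programs without loops and without large constants. -/
def Simple : Prog → Prop
  | skip => True
  | assign _ e => e.SmallConsts
  | write _ i e => i.SmallConsts ∧ e.SmallConsts
  | seq P Q => Simple P ∧ Simple Q
  | ite b P Q => b.SmallConsts ∧ Simple P ∧ Simple Q
  | .while _ _ => False

/-- A bound on the running time of a program without loops. -/
def maxCost : Prog → ℕ
  | skip => 1
  | assign _ e => e.cost + 1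
  | write _ i e => i.cost + e.cost + 1
  | seq P Q => maxCost P + maxCost Q
  | ite b P Q => b.cost + 1 + (maxCost P + maxCost Q)
  | .while _ _ => 0

/-- A program without loops maps a memory with entries of size `K` to a memory with entries of size
`K ^ degree`. -/
def degree : Prog → ℕ
  | skip => 1
  | assign _ e => e.cost
  | write _ i e => i.cost * e.cost
  | seq P Q => degree P * degree Q
  | ite b P Q => b.cost * (degree P * degree Q)
  | .while _ _ => 1

lemma degree_pos (P : Prog) : 0 < P.degree := by
  induction P <;> simp_all [degree, Expr.cost_pos]

/-- The weakest precondition of a program without loops, up to the sizes of numbers. -/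
def wp : Prog → State → (State → Prop) → Prop
  | skip, s, R => R s
  | assign x e, s, R => e.NonnegReads s ∧ R (s.setReg x (e.eval s))
  | write a i e, s, R => i.NonnegReads s ∧ e.NonnegReads s ∧ 0 ≤ i.eval s ∧
      R (s.setArr a (i.eval s).toNat (e.eval s))
  | seq P Q, s, R => wp P s fun s' => wp Q s' R
  | ite b P Q, s, R => b.NonnegReads s ∧ (b.eval s ≠ 0 → wp P s R) ∧ (b.eval s = 0 → wp Q s R)
  | .while _ _, _, _ => False

lemma wp_seq {P Q : Prog} {s : State} {R : State → Prop} (h : P.wp s fun s' => Q.wp s' R) :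
    (seq P Q).wp s R := h

lemma wp_assign {x : ℕ} {e : Expr} {s : State} {R : State → Prop} {z : ℤ} (hr : e.NonnegReads s)
    (hz : e.eval s = z) (h : R (s.setReg x z)) : (assign x e).wp s R :=
  ⟨hr, hz ▸ h⟩

lemma wp_write {a : ℕ} {i e : Expr} {s : State} {R : State → Prop} {j : ℕ} {z : ℤ}
    (hi : i.NonnegReads s) (hj : i.eval s = j) (hr : e.NonnegReads s) (hz : e.eval s = z)
    (h : R (s.setArr a j z)) : (write a i e).wp s R := by
  refine ⟨hi, hr, by omega, ?_⟩
  rw [hj, hz, Int.toNat_natCast]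
  exact h

lemma wp_ite_pos {b : Expr} {P Q : Prog} {s : State} {R : State → Prop} (hr : b.NonnegReads s)
    (hb : b.eval s ≠ 0) (h : P.wp s R) : (ite b P Q).wp s R :=
  ⟨hr, fun _ => h, fun h0 => (hb h0).elim⟩

lemma wp_ite_neg {b : Expr} {P Q : Prog} {s : State} {R : State → Prop} (hr : b.NonnegReads s)
    (hb : b.eval s = 0) (h : Q.wp s R) : (ite b P Q).wp s R :=
  ⟨hr, fun h0 => (h0 hb).elim, fun _ => h⟩

/-- Degrees multiply along a sequence because its second part starts with numbers of size `K ^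
P.degree`. Over many rounds this would explode, so it is applied to single rounds, after which the
loop invariant restores the bound `K`. -/
lemma exec_of_wp {β : ℕ} (P : Prog) (hP : P.Simple) {K : ℕ} (hK : 2 ≤ K) {s : State} (hs : s.Bdd K)
    (hβ : K ^ P.degree ≤ β) {R : State → Prop} (h : P.wp s R) :
    ∃ t s', Exec β P s t s' ∧ t ≤ P.maxCost ∧ s'.Bdd (K ^ P.degree) ∧ R s' := by
  induction P generalizing K s R with
  | skip => exact ⟨1, s, .skip s, le_rfl, by simpa [degree] using hs, h⟩
  | assign x e =>
    obtain ⟨h1, h2⟩ := Expr.eval_le_and_legal hK hs e h.1 hP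
    exact ⟨_, _, .assign s x e (h2 β hβ), le_rfl,
      (hs.mono (Nat.le_self_pow e.cost_pos.ne' K)).setReg x h1, h.2⟩
  | write a i e =>
    obtain ⟨h1, h2⟩ := Expr.eval_le_and_legal hK hs i h.1 hP.1
    obtain ⟨h1', h2'⟩ := Expr.eval_le_and_legal hK hs e h.2.1 hP.2
    have hi : K ^ i.cost ≤ K ^ (i.cost * e.cost) :=
      Nat.pow_le_pow_right (by omega) (Nat.le_mul_of_pos_right _ e.cost_pos)
    have he : K ^ e.cost ≤ K ^ (i.cost * e.cost) :=
      Nat.pow_le_pow_right (by omega) (Nat.le_mul_of_pos_left _ i.cost_pos)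
    exact ⟨_, _, .write s a i e (h2 β (hi.trans hβ)) h.2.2.1 (h2' β (he.trans hβ)), le_rfl,
      (hs.mono ((Nat.le_self_pow i.cost_pos.ne' K).trans hi)).setArr _ _ (h1'.trans he), h.2.2.2⟩
  | seq P Q ihP ihQ =>
    have hKP : K ≤ K ^ P.degree := Nat.le_self_pow P.degree_pos.ne' K
    have hd : K ^ (seq P Q).degree = (K ^ P.degree) ^ Q.degree := pow_mul _ _ _
    rw [hd] at hβ ⊢
    obtain ⟨t, s', h1, h2, h3, h4⟩ := ihP hP.1 hK hs
      ((Nat.le_self_pow Q.degree_pos.ne' _).trans hβ) h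
    obtain ⟨t', s'', h1', h2', h3', h4'⟩ := ihQ hP.2 (hK.trans hKP) h3 hβ h4
    exact ⟨_, s'', .seq h1 h1', add_le_add h2 h2', h3', h4'⟩
  | ite b P Q ihP ihQ =>
    obtain ⟨-, h2⟩ := Expr.eval_le_and_legal hK hs b h.1 hP.1
    have hb : K ^ b.cost ≤ K ^ (ite b P Q).degree := Nat.pow_le_pow_right (by omega)
      (Nat.le_mul_of_pos_right _ (Nat.mul_pos P.degree_pos Q.degree_pos))
    have hp : K ^ P.degree ≤ K ^ (ite b P Q).degree := Nat.pow_le_pow_right (by omega)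
      ((Nat.le_mul_of_pos_right _ Q.degree_pos).trans (Nat.le_mul_of_pos_left _ b.cost_pos))
    have hq : K ^ Q.degree ≤ K ^ (ite b P Q).degree := Nat.pow_le_pow_right (by omega)
      ((Nat.le_mul_of_pos_left _ P.degree_pos).trans (Nat.le_mul_of_pos_left _ b.cost_pos))
    by_cases h0 : b.eval s = 0
    · obtain ⟨t, s', h1', h2', h3', h4'⟩ := ihQ hP.2.2 hK hs (hq.trans hβ) (h.2.2 h0)
      exact ⟨_, s', .iteFalse (h2 β (hb.trans hβ)) h0 h1', by simp only [maxCost]; omega,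
        h3'.mono hq, h4'⟩
    · obtain ⟨t, s', h1', h2', h3', h4'⟩ := ihP hP.2.1 hK hs (hp.trans hβ) (h.2.1 h0)
      exact ⟨_, s', .iteTrue (h2 β (hb.trans hβ)) h0 h1', by simp only [maxCost]; omega,
        h3'.mono hp, h4'⟩
  | _ => exact h.elim

end Prog

lemma Runs.of_wp {β : ℕ} {P : Prog} {K : ℕ} {s : State} {R : State → Prop} (hP : P.Simple)
    (hK : 2 ≤ K) (hs : s.Bdd K) (hβ : K ^ P.degree ≤ β) (h : P.wp s R) :
    Runs β P s P.maxCost R := by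
  obtain ⟨t, s', h1, h2, -, h4⟩ := P.exec_of_wp hP hK hs hβ h
  exact ⟨t, s', h1, h2, h4⟩

end WordRAM

/-! ## Lists of the edges with a given end -/

section EdgeLists

variable {V : Type} [DecidableEq V] (key : ℕ → V)

/-- The last `j` in `{1, …, i}` such that item `j - 1` has the key `u`, or `0`. -/
def lastKey (u : V) : ℕ → ℕ
  | 0 => 0
  | i + 1 => if key i = u then i + 1 else lastKey u i

/-- The number of items below `i` with the key `u`. -/
def countKey (u : V) : ℕ → ℕ
  | 0 => 0
  | i + 1 => countKey u i + if key i = u then 1 else 0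

/-- The length of the list that starts at `c` and runs downwards through items with equal keys. -/
def listLength (c : ℕ) : ℕ := countKey key (key (c - 1)) c

lemma lastKey_le (u : V) (i : ℕ) : lastKey key u i ≤ i := by
  induction i with
  | zero => rfl
  | succ i ih => rw [lastKey]; split_ifs <;> omega

lemma key_lastKey {u : V} {i : ℕ} (h : lastKey key u i ≠ 0) : key (lastKey key u i - 1) = u := by
  induction i with
  | zero => exact (h rfl).elim
  | succ i ih =>
    rw [lastKey] at h ⊢
    split_ifs at h ⊢ with hk
    · exact hk
    · exact ih h

lemma le_lastKey {u : V} {i e : ℕ} (h1 : 1 ≤ e) (h2 : e ≤ i) (hk : key (e - 1) = u) :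
    e ≤ lastKey key u i := by
  induction i with
  | zero => omega
  | succ i ih =>
    rw [lastKey]
    split_ifs with h
    · exact h2
    · refine ih (Nat.lt_succ_iff.1 (lt_of_le_of_ne h2 ?_))
      rintro rfl
      exact h hk

lemma listLength_lastKey (u : V) (i : ℕ) : listLength key (lastKey key u i) = countKey key u i := by
  induction i with
  | zero => rfl
  | succ i ih =>
    rw [lastKey, countKey]
    split_ifs with h
    · rw [listLength, Nat.add_sub_cancel, h, countKey, if_pos h]
    · rw [ih, add_zero]

/-- Following a link shortens the list by one; this pays for taking an in-edge and for advancing a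
candidate. -/
lemma listLength_next {c : ℕ} (hc : c ≠ 0) :
    listLength key (lastKey key (key (c - 1)) (c - 1)) + 1 = listLength key c := by
  obtain ⟨d, rfl⟩ := Nat.exists_eq_succ_of_ne_zero hc
  rw [listLength_lastKey, listLength, Nat.succ_eq_add_one, Nat.add_sub_cancel, countKey, if_pos rfl]

lemma sum_countKey [Fintype V] (i : ℕ) : ∑ u, countKey key u i = i := by
  induction i with
  | zero => simp [countKey]
  | succ i ih => simp [countKey, Finset.sum_add_distrib, ih]

end EdgeLists

/-- A step changes the energy or the candidate of a single node, hence one summand of the potential.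
-/
lemma Finset.sum_add_le_sum_add {ι : Type} [Fintype ι] [DecidableEq ι] {F F' : ι → ℕ} (u : ι)
    {k k' : ℕ} (h : ∀ v, v ≠ u → F' v = F v) (hu : F' u + k ≤ F u + k') :
    ∑ v, F' v + k ≤ ∑ v, F v + k' := by
  have h' : ∑ v ∈ Finset.univ.erase u, F' v = ∑ v ∈ Finset.univ.erase u, F v :=
    Finset.sum_congr rfl fun v hv => h v (Finset.ne_of_mem_erase hv)
  have h1 := Finset.add_sum_erase _ F (Finset.mem_univ u)
  have h2 := Finset.add_sum_erase _ F' (Finset.mem_univ u)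
  omega

/-! ## Value iteration -/

lemma GameGraph.EdgeSat.mono {V : Type} {f f' : V → ℕ∞} {u v : V} {z : ℤ}
    (h : GameGraph.EdgeSat f u v z) (hu : f u ≤ f' u) (hv : f' v ≤ f v) :
    GameGraph.EdgeSat f' u v z := by
  by_cases h' : f' u = ⊤
  · exact Or.inl h'
  obtain ⟨a', ha'⟩ := ENat.ne_top_iff_exists.1 h'
  rcases h with h | ⟨a, b, ha, hb, hab⟩
  · rw [h, top_le_iff] at hu
    exact (h' hu).elim
  · rw [ha, ← ha'] at hu
    have : a ≤ a' := by exact_mod_cast hu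
    exact GameGraph.edgeSat_of_le ha'.symm (hb ▸ hv) (by omega)

/-- If `f` and `g` agreed at the tail, the smaller value of `f` at the head would make the edge
consistent for `f` as well. This strict gap allows raising `f u` without passing `g u`. -/
lemma GameGraph.lt_of_not_edgeSat {V : Type} {f g : V → ℕ∞} {u v : V} {z : ℤ}
    (hf : ¬ GameGraph.EdgeSat f u v z) (hg : GameGraph.EdgeSat g u v z) (hle : ∀ u, f u ≤ g u) :
    f u < g u := by
  refine lt_of_le_of_ne (hle u) fun h => hf (hg.mono h.ge (hle v))

/-- A game in the form in which value iteration uses it: the edges `0, …, m - 1`, the energy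
function `E` that is to be computed, and a bound `cap` on its finite values. -/
structure IterData (n : ℕ) where
  m : ℕ
  src : ℕ → Fin n
  dst : ℕ → Fin n
  wt : ℕ → ℤ
  VA : Finset (Fin n)
  E : Fin n → ℕ∞
  cap : ℕ

namespace IterData

open GameGraph

variable {n : ℕ} (d : IterData n)

/-- Consistency along the edge number `e`, counted from `1`. -/
def Sat (f : Fin n → ℕ∞) (e : ℕ) : Prop :=
  EdgeSat f (d.src (e - 1)) (d.dst (e - 1)) (d.wt (e - 1))

/-- `E` is the least progress measure, with finite values at most `cap`. -/
structure Valid : Prop where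
  bob : ∀ e, 1 ≤ e → e ≤ d.m → d.src (e - 1) ∉ d.VA → d.Sat d.E e
  alice : ∀ u ∈ d.VA, ∃ e, 1 ≤ e ∧ e ≤ d.m ∧ d.src (e - 1) = u ∧ d.Sat d.E e
  least : ∀ f : Fin n → ℕ∞, (∀ e, 1 ≤ e → e ≤ d.m → d.src (e - 1) ∉ d.VA → d.Sat f e) →
    (∀ u ∈ d.VA, ∃ e, 1 ≤ e ∧ e ≤ d.m ∧ d.src (e - 1) = u ∧ d.Sat f e) → ∀ u, d.E u ≤ f u
  cap : ∀ u, d.E u = ⊤ ∨ d.E u ≤ d.cap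

/-- The data of a run of value iteration: the current energies, a candidate edge for each node of
Alice, a stack of lists of incoming edges that have to be checked, and an edge that is being
checked.  Edges are counted from `1`, and `0` means that there is none. -/
structure Run (n : ℕ) where
  f : Fin n → ℕ∞
  ptr : Fin n → ℕ
  stk : ℕ → ℕ
  sp : ℕ
  cur : ℕ

/-- The edge `e` still has to be checked. -/
def Dirty (a : Run n) (e : ℕ) : Prop :=
  e = a.cur ∨ ∃ j < a.sp, e ≤ a.stk j ∧ d.dst (e - 1) = d.dst (a.stk j - 1)

/-- Every violated condition is recorded as dirty: for Bob on each out-edge, for Alice on her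
candidate. Lists run from large to small edge numbers, so `skipped` says that all edges before the
candidate have been refuted. -/
structure Inv (a : Run n) : Prop where
  le : ∀ u, a.f u ≤ d.E u
  cap : ∀ u, a.f u = ⊤ ∨ a.f u ≤ d.cap
  bob : ∀ e, 1 ≤ e → e ≤ d.m → d.src (e - 1) ∉ d.VA → d.Sat a.f e ∨ d.Dirty a e
  ptr_le : ∀ u, a.ptr u ≤ d.m
  ptr_src : ∀ u ∈ d.VA, 1 ≤ a.ptr u ∧ d.src (a.ptr u - 1) = u
  alice : ∀ u ∈ d.VA, d.Sat a.f (a.ptr u) ∨ d.Dirty a (a.ptr u)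
  skipped : ∀ u ∈ d.VA, ∀ e, a.ptr u < e → e ≤ d.m → d.src (e - 1) = u → ¬ d.Sat a.f e
  stk_le : ∀ j < a.sp, a.stk j ≤ d.m
  cur_le : a.cur ≤ d.m

/-- The finite values up to `cap` and the infinite value in their order. -/
def rank (x : ℕ∞) : ℕ := if x = ⊤ then d.cap + 1 else x.toNat

/-- What raising `u` must pay: two units per stacked in-edge (take and check), one for popping the
list, one per restored out-edge, and one for the step itself. -/
def nodeCost (u : Fin n) : ℕ := 2 * countKey d.dst u d.m + countKey d.src u d.m + 2

/-- An upper bound on the number of the remaining steps. -/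
def potential (a : Run n) : ℕ :=
  ∑ u, (d.rank (d.E u) - d.rank (a.f u)) * d.nodeCost u +
    ∑ j ∈ Finset.range a.sp, (2 * listLength d.dst (a.stk j) + 1) +
    ∑ u, listLength d.src (a.ptr u) + if a.cur = 0 then 0 else 1

/-- The next larger value. -/
def raise (x : ℕ∞) : ℕ∞ := if x + 1 ≤ d.cap then x + 1 else ⊤

variable {d}

lemma le_raise (x : ℕ∞) : x ≤ d.raise x := by
  unfold raise
  split_ifs
  exacts [le_self_add, le_top]

lemma raise_le {x y : ℕ∞} (h : x < y) (hy : y = ⊤ ∨ y ≤ d.cap) : d.raise x ≤ y := by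
  have h1 := Order.add_one_le_of_lt h
  unfold raise
  split_ifs with h2
  · exact h1
  · rcases hy with hy | hy
    · exact hy.ge
    · exact (h2 (h1.trans hy)).elim

lemma raise_cap (x : ℕ∞) : d.raise x = ⊤ ∨ d.raise x ≤ d.cap := by
  unfold raise
  split_ifs with h
  exacts [Or.inr h, Or.inl rfl]

lemma rank_coe (x : ℕ) : d.rank x = x := by
  simp [rank]

lemma rank_raise {x : ℕ} (hx : (x : ℕ∞) ≤ d.cap) : d.rank (d.raise x) = d.rank x + 1 := by
  have hx' : x ≤ d.cap := by exact_mod_cast hx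
  rw [rank_coe]
  unfold raise
  split_ifs with h
  · exact_mod_cast d.rank_coe (x + 1)
  · have : ¬ x + 1 ≤ d.cap := fun h' => h (by exact_mod_cast h')
    simp only [rank, if_true]
    omega

lemma rank_lt {x y : ℕ∞} (h : x < y) (hy : y = ⊤ ∨ y ≤ d.cap) (hx : x = ⊤ ∨ x ≤ d.cap) :
    d.rank x < d.rank y := by
  rcases hx with rfl | hx
  · exact absurd h not_top_lt
  obtain ⟨a, rfl⟩ := ENat.ne_top_iff_exists.1 (ne_top_of_lt h)
  have hx' : a ≤ d.cap := by exact_mod_cast hx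
  rw [rank_coe]
  by_cases hy' : y = ⊤
  · simp only [rank, hy', if_true]; omega
  · obtain ⟨b, rfl⟩ := ENat.ne_top_iff_exists.1 hy'
    rw [rank_coe]
    exact_mod_cast h

/-- The same node may be stacked several times, so the stack pointer is bounded by the potential
instead of `n`. -/
lemma sp_le_potential (a : Run n) : a.sp ≤ d.potential a := by
  have h : ∑ _j ∈ Finset.range a.sp, 1 ≤
      ∑ j ∈ Finset.range a.sp, (2 * listLength d.dst (a.stk j) + 1) :=
    Finset.sum_le_sum fun j _ => by omega
  simp only [Finset.sum_const, Finset.card_range, smul_eq_mul, mul_one] at h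
  unfold potential
  omega

/-! The steps of value iteration preserve the invariant and decrease the potential. -/

lemma Inv.pop {a : Run n} (h : d.Inv a) (hc : a.cur = 0) {k : ℕ} (hk : a.sp = k + 1)
    (h0 : a.stk k = 0) :
    d.Inv { a with sp := k } ∧ d.potential { a with sp := k } < d.potential a := by
  have hd : ∀ e, 1 ≤ e → d.Dirty a e → d.Dirty { a with sp := k } e := by
    rintro e he (h1 | ⟨j, hj, h1, h2⟩)
    · omega
    · by_cases hjk : j = k
      · subst hjk; omega
      · exact Or.inr ⟨j, show j < k by omega, h1, h2⟩
  constructor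
  · exact { h with
      bob := fun e h1 h2 h3 => (h.bob e h1 h2 h3).imp_right (hd e h1)
      alice := fun u hu => (h.alice u hu).imp_right (hd _ (h.ptr_src u hu).1)
      stk_le := fun j hj => h.stk_le j (hk ▸ Nat.lt_succ_of_lt hj) }
  · simp only [potential, hk, Finset.sum_range_succ]
    omega

/-- The head of the top list becomes current, and its link replaces it on the stack, so exactly the
same edges stay dirty. Two units of the list become one for the pending check. -/
lemma Inv.take {a : Run n} (h : d.Inv a) (hc : a.cur = 0) {k : ℕ} (hk : a.sp = k + 1)
    (h0 : a.stk k ≠ 0) {a' : Run n} (ha' : a' = { a with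
      cur := a.stk k
      stk := Function.update a.stk k (lastKey d.dst (d.dst (a.stk k - 1)) (a.stk k - 1)) }) :
    d.Inv a' ∧ d.potential a' < d.potential a := by
  have hstk : ∀ j, j ≠ k → a'.stk j = a.stk j := fun j hj => by
    rw [ha']; exact Function.update_of_ne hj _ _
  have hstk' : a'.stk k = lastKey d.dst (d.dst (a.stk k - 1)) (a.stk k - 1) := by
    rw [ha']; exact Function.update_self _ _ _
  have hcur : a'.cur = a.stk k := by rw [ha']
  have hsp : a'.sp = k + 1 := by rw [ha']; exact hk
  have hf : a'.f = a.f := by rw [ha']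
  have hptr : a'.ptr = a.ptr := by rw [ha']
  have hd : ∀ e, 1 ≤ e → d.Dirty a e → d.Dirty a' e := by
    rintro e he (h1 | ⟨j, hj, h1, h2⟩)
    · omega
    · by_cases hjk : j = k
      · subst hjk
        by_cases hej : e = a.stk j
        · exact Or.inl (hej.trans hcur.symm)
        · have hle : e ≤ lastKey d.dst (d.dst (a.stk j - 1)) (a.stk j - 1) :=
            le_lastKey _ he (by omega) h2
          refine Or.inr ⟨j, by omega, hstk' ▸ hle, ?_⟩
          rw [hstk', key_lastKey d.dst (by omega), h2]
      · exact Or.inr ⟨j, by omega, (hstk j hjk).symm ▸ h1, (hstk j hjk).symm ▸ h2⟩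
  constructor
  · constructor
    · rw [hf]; exact h.le
    · rw [hf]; exact h.cap
    · rw [hf]; exact fun e h1 h2 h3 => (h.bob e h1 h2 h3).imp_right (hd e h1)
    · rw [hptr]; exact h.ptr_le
    · rw [hptr]; exact h.ptr_src
    · rw [hptr, hf]; exact fun u hu => (h.alice u hu).imp_right (hd _ (h.ptr_src u hu).1)
    · rw [hptr, hf]; exact h.skipped
    · intro j hj
      by_cases hjk : j = k
      · subst hjk
        rw [hstk']
        exact (lastKey_le _ _ _).trans ((Nat.sub_le _ _).trans (h.stk_le _ (by omega)))
      · rw [hstk j hjk]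
        exact h.stk_le j (by omega)
    · rw [hcur]; exact h.stk_le k (by omega)
  · have h1 : ∑ j ∈ Finset.range k, (2 * listLength d.dst (a'.stk j) + 1) =
        ∑ j ∈ Finset.range k, (2 * listLength d.dst (a.stk j) + 1) :=
      Finset.sum_congr rfl fun j hj => by rw [hstk j (Finset.mem_range.1 hj).ne]
    have := listLength_next d.dst h0
    simp only [potential, hk, hsp, Finset.sum_range_succ, hf, hptr, hcur, hc, hstk', h1]
    rw [if_neg h0]
    simp only [if_true]
    omega

/-- A node of Alice needs only one consistent edge, so an edge other than her candidate may be
dropped unchecked. -/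
lemma Inv.discard {a : Run n} (h : d.Inv a) (hc : a.cur ≠ 0)
    (h1 : d.Sat a.f a.cur ∨
      (d.src (a.cur - 1) ∈ d.VA ∧ a.ptr (d.src (a.cur - 1)) ≠ a.cur)) :
    d.Inv { a with cur := 0 } ∧ d.potential { a with cur := 0 } < d.potential a := by
  have hd : ∀ e, d.Dirty a e → e ≠ a.cur → d.Dirty { a with cur := 0 } e :=
    fun e he hne => Or.inr (he.resolve_left hne)
  constructor
  · exact { h with
      bob := by
        intro e he1 he2 he3
        rcases h.bob e he1 he2 he3 with h2 | h2
        · exact Or.inl h2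
        by_cases hec : e = a.cur
        · subst hec
          exact Or.inl (h1.resolve_right fun h3 => he3 h3.1)
        · exact Or.inr (hd e h2 hec)
      alice := by
        intro u hu
        rcases h.alice u hu with h2 | h2
        · exact Or.inl h2
        by_cases hec : a.ptr u = a.cur
        · refine Or.inl ?_
          change d.Sat a.f (a.ptr u)
          rw [hec]
          refine h1.resolve_right fun h3 => ?_
          rw [← hec, (h.ptr_src u hu).2] at h3
          exact h3.2 rfl
        · exact Or.inr (hd _ h2 hec)
      cur_le := Nat.zero_le _ }
  · simp only [potential, if_neg hc, if_true]
    omega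

/-- The refuted candidate joins the skipped edges, and its successor is made current, hence dirty,
so nothing is claimed about it yet. -/
lemma Inv.advance {a : Run n} (h : d.Inv a) (hc : a.cur ≠ 0) (hs : ¬ d.Sat a.f a.cur)
    {u : Fin n} (hu : d.src (a.cur - 1) = u) (huA : u ∈ d.VA) (hp : a.ptr u = a.cur)
    (hn : lastKey d.src u (a.cur - 1) ≠ 0) {a' : Run n} (ha' : a' = { a with
      ptr := Function.update a.ptr u (lastKey d.src u (a.cur - 1))
      cur := lastKey d.src u (a.cur - 1) }) :
    d.Inv a' ∧ d.potential a' < d.potential a := by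
  set x := lastKey d.src u (a.cur - 1) with hx
  have hxm : x ≤ d.m := (lastKey_le _ _ _).trans ((Nat.sub_le _ _).trans h.cur_le)
  have hpu : a'.ptr u = x := by rw [ha']; exact Function.update_self _ _ _
  have hpv : ∀ v, v ≠ u → a'.ptr v = a.ptr v := fun v hv => by
    rw [ha']; exact Function.update_of_ne hv _ _
  have hcur : a'.cur = x := by rw [ha']
  have hsp : a'.sp = a.sp := by rw [ha']
  have hstk : a'.stk = a.stk := by rw [ha']
  have hf : a'.f = a.f := by rw [ha']
  have hd : ∀ e, d.Dirty a e → e ≠ a.cur → d.Dirty a' e := by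
    intro e he hne
    right
    rw [hsp, hstk]
    exact he.resolve_left hne
  constructor
  · constructor
    · rw [hf]; exact h.le
    · rw [hf]; exact h.cap
    · rw [hf]
      intro e h1 h2 h3
      refine (h.bob e h1 h2 h3).imp_right fun h4 => hd e h4 ?_
      rintro rfl
      exact h3 (hu ▸ huA)
    · intro v
      by_cases hv : v = u
      · rw [hv, hpu]; exact hxm
      · rw [hpv v hv]; exact h.ptr_le v
    · intro v hvA
      by_cases hv : v = u
      · rw [hv, hpu]; exact ⟨by omega, key_lastKey _ hn⟩
      · rw [hpv v hv]; exact h.ptr_src v hvA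
    · intro v hvA
      by_cases hv : v = u
      · rw [hv, hpu]; exact Or.inr (Or.inl hcur.symm)
      · rw [hpv v hv, hf]
        refine (h.alice v hvA).imp_right fun h4 => hd _ h4 fun h5 => hv ?_
        rw [← (h.ptr_src v hvA).2, h5, hu]
    · intro v hvA e he hem hev
      rw [hf]
      by_cases hv : v = u
      · subst hv
        rw [hpu] at he
        rcases lt_trichotomy e a.cur with h5 | h5 | h5
        · have := le_lastKey d.src (i := a.cur - 1) (by omega) (by omega) hev
          omega
        · rw [h5]; exact hs
        · exact h.skipped v hvA e (hp ▸ h5) hem hev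
      · rw [hpv v hv] at he
        exact h.skipped v hvA e he hem hev
    · rw [hsp, hstk]; exact h.stk_le
    · rw [hcur]; exact hxm
  · have h1 : ∑ v, listLength d.src (a'.ptr v) + 1 ≤ ∑ v, listLength d.src (a.ptr v) + 0 := by
      refine Finset.sum_add_le_sum_add u (fun v hv => by rw [hpv v hv]) ?_
      have := listLength_next d.src hc
      rw [hu, ← hx] at this
      rw [hpu, hp]
      omega
    simp only [potential, hsp, hstk, hf, hcur, if_neg hc, if_neg hn]
    omega

/-- Raising `u` can spoil only the edges into `u`, and all of these are pushed. At a node of Alice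
the scan restarts, since raising `u` may make refuted edges consistent; at a node of Bob the same
edge is checked again. -/
lemma Inv.lift (hd : d.Valid) {a : Run n} (h : d.Inv a) (hc : a.cur ≠ 0) (hs : ¬ d.Sat a.f a.cur)
    {u : Fin n} (hu : d.src (a.cur - 1) = u)
    (hA : u ∈ d.VA → a.ptr u = a.cur ∧ lastKey d.src u (a.cur - 1) = 0) {a' : Run n}
    (hf : a'.f = Function.update a.f u (d.raise (a.f u)))
    (hstk : a'.stk = Function.update a.stk a.sp (lastKey d.dst u d.m))
    (hsp : a'.sp = a.sp + 1)
    (hptr : a'.ptr = if u ∈ d.VA then Function.update a.ptr u (lastKey d.src u d.m) else a.ptr)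
    (hcur : a'.cur = if u ∈ d.VA then lastKey d.src u d.m else a.cur) :
    d.Inv a' ∧ d.potential a' < d.potential a := by
  -- At a node of Alice the whole list is refuted: larger numbers by `skipped`, the candidate by
  -- `hs`, and there are no smaller ones. Some edge is consistent for `E`, so `f` lies strictly
  -- below `E` at `u`.
  have hlt : a.f u < d.E u := by
    by_cases huA : u ∈ d.VA
    · obtain ⟨hp, hl⟩ := hA huA
      obtain ⟨e, he1, hem, heu, hes⟩ := hd.alice u huA
      have hns : ¬ d.Sat a.f e := by
        rcases lt_trichotomy e a.cur with h5 | h5 | h5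
        · have := le_lastKey d.src (i := a.cur - 1) he1 (by omega) heu
          omega
        · rw [h5]; exact hs
        · exact h.skipped u huA e (hp ▸ h5) hem heu
      rw [← heu]
      exact lt_of_not_edgeSat hns hes h.le
    · rw [← hu] at huA ⊢
      exact lt_of_not_edgeSat hs (hd.bob _ (by omega) h.cur_le huA) h.le
  have hfu : a'.f u = d.raise (a.f u) := by rw [hf]; exact Function.update_self _ _ _
  have hfv : ∀ v, v ≠ u → a'.f v = a.f v := fun v hv => by
    rw [hf]; exact Function.update_of_ne hv _ _
  have hle : ∀ v, a.f v ≤ a'.f v := by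
    intro v
    by_cases hv : v = u
    · rw [hv, hfu]; exact le_raise _
    · rw [hfv v hv]
  have hstk1 : ∀ j < a.sp, a'.stk j = a.stk j := fun j hj => by
    rw [hstk]; exact Function.update_of_ne hj.ne _ _
  have hstk2 : a'.stk a.sp = lastKey d.dst u d.m := by
    rw [hstk]; exact Function.update_self _ _ _
  have hpv : ∀ v, v ≠ u → a'.ptr v = a.ptr v := by
    intro v hv
    rw [hptr]
    split_ifs
    · exact Function.update_of_ne hv _ _
    · rfl
  have hpu : u ∈ d.VA → a'.ptr u = lastKey d.src u d.m := fun huA => by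
    rw [hptr, if_pos huA]; exact Function.update_self _ _ _
  have hfirst : u ∈ d.VA → lastKey d.src u d.m ≠ 0 := by
    intro huA
    obtain ⟨e, he1, hem, heu, -⟩ := hd.alice u huA
    have := le_lastKey d.src he1 hem heu
    omega
  have hdirty : ∀ e, d.Dirty a e → e ≠ a.cur → d.Dirty a' e := by
    rintro e (he | ⟨j, hj, h1, h2⟩) hne
    · exact (hne he).elim
    · exact Or.inr ⟨j, by omega, (hstk1 j hj).symm ▸ h1, (hstk1 j hj).symm ▸ h2⟩
  have hin : ∀ e, 1 ≤ e → e ≤ d.m → d.dst (e - 1) = u → d.Dirty a' e := by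
    intro e h1 h2 h3
    have h4 := le_lastKey d.dst h1 h2 h3
    refine Or.inr ⟨a.sp, by omega, hstk2 ▸ h4, ?_⟩
    rw [hstk2, key_lastKey d.dst (by omega), h3]
  have hsat : ∀ e, d.dst (e - 1) ≠ u → d.Sat a.f e → d.Sat a'.f e := by
    intro e hne he
    exact EdgeSat.mono he (hle _) (hfv _ hne).le
  constructor
  · constructor
    · intro v
      by_cases hv : v = u
      · rw [hv, hfu]; exact raise_le hlt (hd.cap u)
      · rw [hfv v hv]; exact h.le v
    · intro v
      by_cases hv : v = u
      · rw [hv, hfu]; exact raise_cap _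
      · rw [hfv v hv]; exact h.cap v
    · intro e h1 h2 h3
      by_cases hdst : d.dst (e - 1) = u
      · exact Or.inr (hin e h1 h2 hdst)
      rcases h.bob e h1 h2 h3 with h4 | h4
      · exact Or.inl (hsat e hdst h4)
      · right
        by_cases hec : e = a.cur
        · left
          rw [hcur, if_neg, hec]
          rwa [← hu, ← hec]
        · exact hdirty e h4 hec
    · intro v
      rw [hptr]
      split_ifs
      · by_cases hv : v = u
        · rw [hv, Function.update_self]; exact lastKey_le _ _ _
        · rw [Function.update_of_ne hv]; exact h.ptr_le v
      · exact h.ptr_le v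
    · intro v hvA
      by_cases hv : v = u
      · subst hv
        rw [hpu hvA]
        exact ⟨Nat.one_le_iff_ne_zero.2 (hfirst hvA), key_lastKey _ (hfirst hvA)⟩
      · rw [hpv v hv]; exact h.ptr_src v hvA
    · intro v hvA
      by_cases hv : v = u
      · subst hv
        rw [hpu hvA]
        exact Or.inr (Or.inl (by rw [hcur, if_pos hvA]))
      · rw [hpv v hv]
        by_cases hdst : d.dst (a.ptr v - 1) = u
        · exact Or.inr (hin _ (h.ptr_src v hvA).1 (h.ptr_le v) hdst)
        refine (h.alice v hvA).imp (hsat _ hdst) fun h4 => hdirty _ h4 fun h5 => hv ?_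
        rw [← (h.ptr_src v hvA).2, h5, hu]
    · intro v hvA e he hem hev
      by_cases hv : v = u
      · subst hv
        rw [hpu hvA] at he
        have := le_lastKey d.src (i := d.m) (by omega) hem hev
        omega
      · rw [hpv v hv] at he
        -- Heads only rise and `f v` is unchanged, so an edge refuted at `v` stays refuted.
        intro h4
        refine h.skipped v hvA e he hem hev (EdgeSat.mono h4 ?_ (hle _))
        rw [hev, hfv v hv]
    · intro j hj
      by_cases hjs : j < a.sp
      · rw [hstk1 j hjs]; exact h.stk_le j hjs
      · rw [show j = a.sp by omega, hstk2]; exact lastKey_le _ _ _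
    · rw [hcur]
      split_ifs
      exacts [lastKey_le _ _ _, h.cur_le]
  · obtain ⟨x, hx⟩ := ENat.ne_top_iff_exists.1 (ne_top_of_lt hlt)
    have hxc : (x : ℕ∞) ≤ d.cap := by
      rw [hx]
      exact (h.cap u).resolve_left (ne_top_of_lt hlt)
    have h1 : ∑ v, (d.rank (d.E v) - d.rank (a'.f v)) * d.nodeCost v + d.nodeCost u ≤
        ∑ v, (d.rank (d.E v) - d.rank (a.f v)) * d.nodeCost v + 0 := by
      refine Finset.sum_add_le_sum_add u (fun v hv => by rw [hfv v hv]) ?_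
      have h2 := rank_lt hlt (hd.cap u) (h.cap u)
      rw [hfu, ← hx, rank_raise hxc, hx, add_zero, ← Nat.succ_mul]
      exact Nat.mul_le_mul_right _ (by omega)
    have h2 : ∑ v, listLength d.src (a'.ptr v) + 0 ≤
        ∑ v, listLength d.src (a.ptr v) + countKey d.src u d.m := by
      refine Finset.sum_add_le_sum_add u (fun v hv => by rw [hpv v hv]) ?_
      by_cases huA : u ∈ d.VA
      · rw [hpu huA, listLength_lastKey]; omega
      · rw [hptr, if_neg huA]; omega
    have h3 : ∑ j ∈ Finset.range a'.sp, (2 * listLength d.dst (a'.stk j) + 1) =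
        ∑ j ∈ Finset.range a.sp, (2 * listLength d.dst (a.stk j) + 1) +
          (2 * countKey d.dst u d.m + 1) := by
      rw [hsp, Finset.sum_range_succ, hstk2, listLength_lastKey]
      congr 1
      exact Finset.sum_congr rfl fun j hj => by rw [hstk1 j (Finset.mem_range.1 hj)]
    have h4 : (if a'.cur = 0 then 0 else 1) ≤ 1 := by split_ifs <;> omega
    unfold potential
    rw [h3, if_neg hc]
    unfold nodeCost at h1 ⊢
    omega

/-- With nothing dirty, `f` is itself a progress measure, hence above the least one; the invariant
gives the other inequality. -/
lemma Inv.eq_of_done (hd : d.Valid) {a : Run n} (h : d.Inv a) (hc : a.cur = 0) (hsp : a.sp = 0) :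
    a.f = d.E := by
  have hclean : ∀ e, 1 ≤ e → ¬ d.Dirty a e := by
    rintro e he (h1 | ⟨j, hj, -⟩) <;> omega
  funext u
  refine le_antisymm (h.le u) (hd.least a.f (fun e h1 h2 h3 => ?_) (fun v hv => ?_) u)
  · exact (h.bob e h1 h2 h3).resolve_right (hclean e h1)
  · obtain ⟨h1, h2⟩ := h.ptr_src v hv
    exact ⟨a.ptr v, h1, h.ptr_le v, h2, (h.alice v hv).resolve_right (hclean _ h1)⟩

/-- The start of value iteration from the energies `f`. -/
def start (d : IterData n) (f : Fin n → ℕ∞) : Run n where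
  f := f
  ptr u := lastKey d.src u d.m
  stk j := if h : j < n then lastKey d.dst ⟨j, h⟩ d.m else 0
  sp := n
  cur := 0

lemma inv_start (hd : d.Valid) {f : Fin n → ℕ∞} (hle : ∀ u, f u ≤ d.E u)
    (hcap : ∀ u, f u = ⊤ ∨ f u ≤ d.cap) : d.Inv (d.start f) := by
  have hdirty : ∀ e, 1 ≤ e → e ≤ d.m → d.Dirty (d.start f) e := by
    intro e h1 h2
    have h3 := le_lastKey d.dst h1 h2 rfl
    refine Or.inr ⟨d.dst (e - 1), (d.dst (e - 1)).2, ?_, ?_⟩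
    · simpa [start] using h3
    · simp only [start, Fin.is_lt, dif_pos, Fin.eta]
      rw [key_lastKey d.dst (by omega)]
  have hptr : ∀ u ∈ d.VA, 1 ≤ lastKey d.src u d.m := by
    intro u hu
    obtain ⟨e, he1, hem, heu, -⟩ := hd.alice u hu
    exact he1.trans (le_lastKey d.src he1 hem heu)
  refine ⟨hle, hcap, fun e h1 h2 _ => Or.inr (hdirty e h1 h2), fun u => lastKey_le _ _ _,
    fun u hu => ⟨hptr u hu, key_lastKey _ (Nat.one_le_iff_ne_zero.1 (hptr u hu))⟩,
    fun u hu => Or.inr (hdirty _ (hptr u hu) (lastKey_le _ _ _)), fun u hu e he hem heu => ?_, ?_,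
    Nat.zero_le _⟩
  · have := le_lastKey d.src (i := d.m) (by omega) hem heu
    exact absurd he (not_lt.2 this)
  · intro j _
    simp only [start]
    split_ifs
    exacts [lastKey_le _ _ _, Nat.zero_le _]

/-- The node costs sum to `3 * m + 2 * n`, and this is paid at most `r` times. The initial lists
cost `3 * m + n`, which one further copy covers. -/
lemma potential_start_le {f : Fin n → ℕ∞} {r : ℕ} (hr : ∀ u, d.rank (d.E u) ≤ d.rank (f u) + r) :
    d.potential (d.start f) ≤ (r + 1) * (3 * d.m + 2 * n) := by
  have h1 : ∑ u, (d.rank (d.E u) - d.rank (f u)) * d.nodeCost u ≤ r * (3 * d.m + 2 * n) := by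
    have h2 : ∑ u, d.nodeCost u = 3 * d.m + 2 * n := by
      simp only [nodeCost, Finset.sum_add_distrib, ← Finset.mul_sum, sum_countKey,
        Finset.sum_const, Finset.card_univ, Fintype.card_fin, smul_eq_mul]
      ring
    rw [← h2, Finset.mul_sum]
    refine Finset.sum_le_sum fun u _ => Nat.mul_le_mul_right _ ?_
    have := hr u
    omega
  have h2 : ∑ j ∈ Finset.range n, (2 * listLength d.dst ((d.start f).stk j) + 1) = 2 * d.m + n := by
    rw [Finset.sum_range]
    simp only [start, Fin.is_lt, dif_pos, Fin.eta, listLength_lastKey, Finset.sum_add_distrib,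
      ← Finset.mul_sum, sum_countKey]
    simp
  have h3 : ∑ u, listLength d.src ((d.start f).ptr u) = d.m := by
    simp only [start, listLength_lastKey, sum_countKey]
  unfold potential
  rw [h3, show (d.start f).sp = n from rfl, h2, show (d.start f).cur = 0 from rfl, if_pos rfl]
  change ∑ u, (d.rank (d.E u) - d.rank (f u)) * d.nodeCost u + (2 * d.m + n) + d.m + 0 ≤ _
  nlinarith

end IterData

/-! ## The program -/

namespace WordRAM

@[simp] lemma State.setReg_reg (s : State) (x y : ℕ) (z : ℤ) :
    (s.setReg x z).reg y = if y = x then z else s.reg y := by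
  simp [State.setReg, Function.update_apply]

@[simp] lemma State.setReg_arr (s : State) (x : ℕ) (z : ℤ) : (s.setReg x z).arr = s.arr := rfl

@[simp] lemma State.setArr_reg (s : State) (a i : ℕ) (z : ℤ) : (s.setArr a i z).reg = s.reg := rfl

@[simp] lemma State.setArr_arr (s : State) (a i b j : ℕ) (z : ℤ) :
    (s.setArr a i z).arr b j = if b = a ∧ j = i then z else s.arr b j := by
  simp only [State.setArr, Function.update_apply]
  by_cases h : b = a
  · subst h; simp [Function.update_apply]
  · simp [h]

end WordRAM

namespace EnergyProgram

open WordRAM Prog Expr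

/-- Registers: `0, …, 4` input; `5` unit of the rounded weights; `6` loop counter; `7` stack size;
`8` current edge; `9` bound on the finite energies; `10`, `11` its tail and head. -/
abbrev rUnit : Expr := reg 5
abbrev rI : Expr := reg 6
abbrev rSp : Expr := reg 7
abbrev rCur : Expr := reg 8
abbrev rCap : Expr := reg 9
abbrev rU : Expr := reg 10
abbrev rV : Expr := reg 11

abbrev plus (e e' : Expr) : Expr := op .add e e'
abbrev minus (e e' : Expr) : Expr := op .sub e e'
abbrev times (e e' : Expr) : Expr := op .mul e e'
abbrev less (e e' : Expr) : Expr := op .lt e e'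

/-- Insert the edge number `i` into the lists of the out-edges and the in-edges. -/
def linkStep : Prog :=
  seq (write 6 (plus rI (const 1)) (read 5 (read 1 rI))) <|
  seq (write 5 (read 1 rI) (plus rI (const 1))) <|
  seq (write 8 (plus rI (const 1)) (read 7 (read 2 rI))) <|
  seq (write 7 (read 2 rI) (plus rI (const 1))) <|
  assign 6 (plus rI (const 1))

/-- Build the lists of the out-edges (arrays `5`, `6`) and the in-edges (arrays `7`, `8`). -/
def link : Prog := seq (assign 6 (const 0)) (.while (less rI (reg 1)) linkStep)

/-- Double the energy (array `4`) of the node `i`, and put its lists into the arrays `9` and `10`. -/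
def resetStep : Prog :=
  seq (write 9 rI (read 5 rI)) <|
  seq (write 10 rI (read 7 rI)) <|
  seq (ite (less (read 4 rI) (const 0)) skip (write 4 rI (times (const 2) (read 4 rI)))) <|
  assign 6 (plus rI (const 1))

def resetInit : Prog := seq (assign 9 (op .div (reg 2) rUnit)) (assign 6 (const 0))

def resetDone : Prog := seq (assign 7 (reg 0)) (assign 8 (const 0))

def reset : Prog := seq resetInit (seq (.while (less rI (reg 0)) resetStep) resetDone)

/-- Is the current edge consistent for the rounded weights? -/
def satExpr : Expr :=
  -- Sums of truth values act as disjunction and products as conjunction. A negative energy codes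
  -- infinity, rounding up is minus the floor of the negated quotient, and the final `+ 1` turns `<`
  -- into `≤`.
  plus (less (read 4 rU) (const 0))
    (times (op .eq (less (read 4 rV) (const 0)) (const 0))
      (less (read 4 rV) (plus (plus (read 4 rU)
        (minus (const 0) (op .div (minus (const 0) (read 3 (minus rCur (const 1)))) rUnit)))
        (const 1))))

/-- Increase the energy of the tail, and push its in-edges. -/
def liftProg : Prog :=
  seq (ite (less (read 4 rU) rCap) (write 4 rU (plus (read 4 rU) (const 1)))
    (write 4 rU (const (-1)))) <|
  seq (write 10 rSp (read 7 rU)) (assign 7 (plus rSp (const 1)))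

def checkEdge : Prog :=
  seq (assign 10 (read 1 (minus rCur (const 1)))) <|
  seq (assign 11 (read 2 (minus rCur (const 1)))) <|
  ite satExpr (assign 8 (const 0)) <|
  ite (read 0 rU)
    (ite (op .eq (read 9 rU) rCur)
      (ite (read 6 rCur)
        (seq (assign 8 (read 6 rCur)) (write 9 rU rCur))
        (seq liftProg (seq (assign 8 (read 5 rU)) (write 9 rU rCur))))
      (assign 8 (const 0)))
    liftProg

def popEdge : Prog :=
  ite (read 10 (minus rSp (const 1)))
    (seq (assign 8 (read 10 (minus rSp (const 1)))) (write 10 (minus rSp (const 1)) (read 8 rCur)))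
    (assign 7 (minus rSp (const 1)))

/-- One step of value iteration. -/
def iterStep : Prog := ite rCur checkEdge popEdge

def iterate : Prog := .while (plus rCur rSp) iterStep

/-- Compute the energies for the weights that are rounded up to multiples of the unit. -/
def phase : Prog := seq reset iterate

/-- Doubling must keep the unit at most `p / q`, as the rounding bound requires. Once `2 * n`
doubled units exceed `M`, a coarser unit would not help: the first phase already costs only `O(m *
n)`. -/
def unitGuard : Expr :=
  times (less (times (times (const 2) rUnit) (reg 4)) (plus (reg 3) (const 1)))
    (less (times (times (const 2) rUnit) (times (const 2) (reg 0))) (plus (reg 2) (const 1)))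

/-- Find the first unit. -/
def chooseUnit : Prog :=
  seq (assign 5 (const 1)) (.while unitGuard (assign 5 (times (const 2) rUnit)))

/-- Halve the unit until it is one. -/
def refineLoop : Prog :=
  .while (less (const 1) rUnit) (seq (assign 5 (op .div rUnit (const 2))) phase)

def main : Prog := seq link (seq chooseUnit (seq phase refineLoop))

/-! ## Verification of the program -/

/-- The numbers that occur within one step are bounded by this power of the earlier ones. -/
def exponent : ℕ :=
  -- The summand 100 covers the loop guards and the short assignments.
  100 + linkStep.degree + resetInit.degree + resetStep.degree + iterStep.degree

end EnergyProgram

/-- A weighted game that is given by lists of the tails, the heads, and the weights of its edges,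
and the numbers of the input. -/
structure EdgeListGame (n : ℕ) where
  m : ℕ
  M : ℕ
  p : ℕ
  q : ℕ
  src : ℕ → Fin n
  dst : ℕ → Fin n
  wt : ℕ → ℤ
  VA : Finset (Fin n)

namespace EdgeListGame

open WordRAM Prog EnergyProgram

variable {n : ℕ} (g : EdgeListGame n)

/-- Weights rounded up to multiples of `B`. -/
def roundUp (B : ℕ) (z : ℤ) : ℤ := 0 - (0 - z) / B

def iterData (B : ℕ) (E : Fin n → ℕ∞) : IterData n where
  m := g.m
  src := g.src
  dst := g.dst
  wt i := roundUp B (g.wt i)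
  VA := g.VA
  E := E
  cap := g.M / B

/-- The memory contains the input, and its numbers are bounded. -/
structure InputRep (K : ℕ) (s : State) : Prop where
  r0 : s.reg 0 = n
  r1 : s.reg 1 = g.m
  r2 : s.reg 2 = g.M
  r3 : s.reg 3 = g.p
  r4 : s.reg 4 = g.q
  a0 : ∀ u : Fin n, s.arr 0 u = if u ∈ g.VA then 1 else 0
  a1 : ∀ i < g.m, s.arr 1 i = (g.src i : ℕ)
  a2 : ∀ i < g.m, s.arr 2 i = (g.dst i : ℕ)
  a3 : ∀ i < g.m, s.arr 3 i = g.wt i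
  bdd : s.Bdd K

/-- The lists of the first `i` edges are built. -/
structure LinkRep (i : ℕ) (s : State) : Prop where
  a5 : ∀ u : Fin n, s.arr 5 u = lastKey g.src u i
  a6 : ∀ e, 1 ≤ e → e ≤ i → s.arr 6 e = lastKey g.src (g.src (e - 1)) (e - 1)
  a7 : ∀ u : Fin n, s.arr 7 u = lastKey g.dst u i
  a8 : ∀ e, 1 ≤ e → e ≤ i → s.arr 8 e = lastKey g.dst (g.dst (e - 1)) (e - 1)

variable {g}

lemma InputRep.setReg {K : ℕ} {s : State} (h : g.InputRep K s) {x : ℕ} (hx : 5 ≤ x) {z : ℤ}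
    (hz : z.natAbs ≤ K) : g.InputRep K (s.setReg x z) := by
  refine ⟨?_, ?_, ?_, ?_, ?_, h.a0, h.a1, h.a2, h.a3, h.bdd.setReg x hz⟩
  all_goals rw [State.setReg_reg, if_neg (by omega)]
  exacts [h.r0, h.r1, h.r2, h.r3, h.r4]

lemma InputRep.setArr {K : ℕ} {s : State} (h : g.InputRep K s) {a : ℕ} (ha : 4 ≤ a) (i : ℕ) {z : ℤ}
    (hz : z.natAbs ≤ K) : g.InputRep K (s.setArr a i z) := by
  refine ⟨h.r0, h.r1, h.r2, h.r3, h.r4, fun u => ?_, fun j hj => ?_, fun j hj => ?_,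
    fun j hj => ?_, h.bdd.setArr a i hz⟩
  all_goals rw [State.setArr_arr, if_neg (by omega)]
  exacts [h.a0 u, h.a1 j hj, h.a2 j hj, h.a3 j hj]

variable (g) in
/-- The memory contains the input and the complete lists. -/
structure Base (K : ℕ) (s : State) : Prop extends g.InputRep K s, g.LinkRep g.m s

lemma Base.setReg {K : ℕ} {s : State} (h : g.Base K s) {x : ℕ} (hx : 5 ≤ x) {z : ℤ}
    (hz : z.natAbs ≤ K) : g.Base K (s.setReg x z) :=
  ⟨h.toInputRep.setReg hx hz, h.a5, h.a6, h.a7, h.a8⟩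

lemma Base.setArr {K : ℕ} {s : State} (h : g.Base K s) {a : ℕ} (ha : a = 4 ∨ 9 ≤ a) (i : ℕ) {z : ℤ}
    (hz : z.natAbs ≤ K) : g.Base K (s.setArr a i z) := by
  refine ⟨h.toInputRep.setArr (by omega) i hz, fun u => ?_, fun e h1 h2 => ?_, fun u => ?_,
    fun e h1 h2 => ?_⟩
  all_goals rw [State.setArr_arr, if_neg (by omega)]
  exacts [h.a5 u, h.a6 e h1 h2, h.a7 u, h.a8 e h1 h2]

lemma encodeEnergy_top : encodeEnergy ⊤ = -1 := by simp [encodeEnergy]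

lemma encodeEnergy_coe (x : ℕ) : encodeEnergy (x : ℕ∞) = x := by simp [encodeEnergy]

/-! ### Building the lists -/

lemma runs_link {K β : ℕ} (hK : 2 ≤ K) (hm : g.m ≤ K) (hβ : K ^ exponent ≤ β) {s : State}
    (hs : g.InputRep K s) (h5 : ∀ i, s.arr 5 i = 0) (h7 : ∀ i, s.arr 7 i = 0)
    (h4 : ∀ i, s.arr 4 i = 0) :
    Runs β link s (60 * (g.m + 1)) fun s' => g.Base K s' ∧ ∀ i, s'.arr 4 i = 0 := by
  have hpow : ∀ c, c ≤ exponent → K ^ c ≤ β := fun c hc =>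
    (Nat.pow_le_pow_right (by omega) hc).trans hβ
  have hinit : Runs β (assign 6 (.const 0)) s 2 fun s' =>
      g.InputRep K s' ∧ g.LinkRep 0 s' ∧ s'.reg 6 = (0 : ℕ) ∧ ∀ i, s'.arr 4 i = 0 := by
    refine Runs.of_wp (by simp [Simple, Expr.SmallConsts]) hK hs.bdd
      (hpow _ (by simp [degree, Expr.cost, exponent]; omega)) ?_
    simp only [wp, Expr.NonnegReads, Expr.eval, true_and]
    refine ⟨hs.setReg (by norm_num) (by simp), ⟨?_, ?_, ?_, ?_⟩, by simp, h4⟩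
    · intro u; exact h5 u
    · intro e h1 h2; omega
    · intro u; exact h7 u
    · intro e h1 h2; omega
  refine (hinit.seq fun s₁ hs₁ => Runs.while_of_potential
    (I := fun i s' => i ≤ g.m ∧ g.InputRep K s' ∧ g.LinkRep i s' ∧ s'.reg 6 = (i : ℕ) ∧
      ∀ i, s'.arr 4 i = 0) (fun i => g.m - i) linkStep.maxCost ?_ ?_ 0 s₁
      ⟨Nat.zero_le _, hs₁⟩).mono ?_ ?_
  · rintro i s' ⟨-, h, -⟩
    exact (Expr.eval_le_and_legal hK h.bdd (less rI (.reg 1)) (by simp [Expr.NonnegReads])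
      (by simp [Expr.SmallConsts])).2 β (hpow _ (by simp [Expr.cost, exponent]; omega))
  · rintro i s' ⟨hi, h, hl, h6, h4⟩ hg
    simp only [Expr.eval, Op.eval, h6, h.r1, Nat.cast_lt] at hg
    have him : i < g.m := by
      by_contra hc; simp [hc] at hg
    refine Runs.of_wp (by simp [linkStep, Simple, Expr.SmallConsts]) hK h.bdd
      (hpow _ (by unfold exponent; omega)) ?_
    have hb : ((i : ℤ) + 1).natAbs ≤ K := by omega
    have e1 : ((i : ℤ) + 1).toNat = i + 1 := by omega
    simp only [linkStep, wp, Expr.NonnegReads, Expr.eval, Op.eval, State.setArr_reg,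
      State.setArr_arr, h6, Int.toNat_natCast, h.a1 i him, h.a2 i him, e1]
    simp
    refine ⟨by omega, i + 1, ⟨him, ?_, ?_, by simp, h4⟩, by omega⟩
    · exact InputRep.setReg (.setArr (.setArr (.setArr (.setArr h (by norm_num) _ (h.bdd.2 _ _))
        (by norm_num) _ hb) (by norm_num) _ (h.bdd.2 _ _)) (by norm_num) _ hb) (by norm_num) hb
    · constructor
      · intro u
        by_cases hu : g.src i = u
        · simp [lastKey, hu]
        · have : (u : ℕ) ≠ g.src i := fun h => hu (Fin.ext h).symm
          simp [lastKey, hu, this, hl.a5]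
      · intro e h1 h2
        by_cases he : e = i + 1
        · simp [he, hl.a5]
        · simp [he, hl.a6 e h1 (by omega)]
      · intro u
        by_cases hu : g.dst i = u
        · simp [lastKey, hu]
        · have : (u : ℕ) ≠ g.dst i := fun h => hu (Fin.ext h).symm
          simp [lastKey, hu, this, hl.a7]
      · intro e h1 h2
        by_cases he : e = i + 1
        · simp [he, hl.a7]
        · simp [he, hl.a8 e h1 (by omega)]
  · simp only [linkStep, maxCost, Expr.cost]
    omega
  · rintro s' ⟨i, ⟨hi, h, hl, h6, h4⟩, hg⟩
    simp only [Expr.eval, Op.eval, h6, h.r1, Nat.cast_lt] at hg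
    have him : i = g.m := by
      by_contra hc
      have : i < g.m := by omega
      simp [this] at hg
    subst him
    exact ⟨⟨h, hl⟩, h4⟩

/-! ### Starting a phase -/

variable (g) in
/-- The memory represents the state `a` of value iteration for the unit `B`. -/
structure Rep (K B : ℕ) (a : IterData.Run n) (s : State) : Prop extends g.Base K s where
  r5 : s.reg 5 = B
  r7 : s.reg 7 = a.sp
  r8 : s.reg 8 = a.cur
  r9 : s.reg 9 = (g.M / B : ℕ)
  a4 : ∀ u : Fin n, s.arr 4 u = encodeEnergy (a.f u)
  a9 : ∀ u : Fin n, s.arr 9 u = a.ptr u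
  a10 : ∀ j < a.sp, s.arr 10 j = a.stk j

/-- Halving the unit doubles the energies known so far, and this is the next starting point. The
first phase uses the same code with `f = 0`. -/
lemma runs_reset {K β B : ℕ} (hK : 2 ≤ K) (hn : n ≤ K) (hm : g.m ≤ K) (hM : g.M ≤ K)
    (hβ : K ^ exponent ≤ β) {f : Fin n → ℕ∞} (hf : ∀ u, 2 * f u = ⊤ ∨ 2 * f u ≤ K) {s : State}
    (hs : g.Base K s) (h5 : s.reg 5 = B) (h4 : ∀ u : Fin n, s.arr 4 u = encodeEnergy (f u))
    (E : Fin n → ℕ∞) :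
    Runs β reset s (60 * (n + 1)) (g.Rep K B ((g.iterData B E).start fun u => 2 * f u)) := by
  have hpow : ∀ c, c ≤ exponent → K ^ c ≤ β := fun c hc =>
    (Nat.pow_le_pow_right (by omega) hc).trans hβ
  have hinit : Runs β resetInit s resetInit.maxCost fun s' =>
      g.Base K s' ∧ s'.reg 5 = B ∧ s'.reg 9 = (g.M / B : ℕ) ∧ s'.reg 6 = (0 : ℕ) ∧
        ∀ u : Fin n, s'.arr 4 u = encodeEnergy (f u) := by
    refine Runs.of_wp (by simp [resetInit, Simple, Expr.SmallConsts]) hK hs.bdd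
      (hpow _ (by unfold exponent; omega)) ?_
    simp only [resetInit, wp, Expr.NonnegReads, Expr.eval, Op.eval, true_and]
    have hb : ((g.M : ℤ) / B).natAbs ≤ K := by
      rw [← Int.natCast_ediv]
      exact (Nat.div_le_self _ _).trans hM
    rw [hs.r2, h5]
    refine ⟨(hs.setReg (by norm_num) hb).setReg (by norm_num) (by simp), ?_, ?_, ?_, h4⟩ <;>
      simp [h5]
  refine (hinit.seq fun s₁ hs₁ => (Runs.while_of_potential
    (I := fun i s' => i ≤ n ∧ g.Base K s' ∧ s'.reg 5 = B ∧ s'.reg 9 = (g.M / B : ℕ) ∧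
      s'.reg 6 = (i : ℕ) ∧ ∀ u : Fin n, if u.1 < i then s'.arr 4 u = encodeEnergy (2 * f u) ∧
        s'.arr 9 u = lastKey g.src u g.m ∧ s'.arr 10 u = lastKey g.dst u g.m
      else s'.arr 4 u = encodeEnergy (f u)) (fun i => n - i) resetStep.maxCost ?_ ?_ 0 s₁ ?_).seq
      (P' := resetDone) (T' := resetDone.maxCost) fun s₂ hs₂ => ?_).mono ?_ fun _ h => h
  · rintro i s' ⟨-, h, -⟩
    exact (Expr.eval_le_and_legal hK h.bdd (less rI (.reg 0)) (by simp [Expr.NonnegReads])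
      (by simp [Expr.SmallConsts])).2 β (hpow _ (by simp [Expr.cost, exponent]; omega))
  · rintro i s' ⟨hi, h, h5, h9, h6, hu⟩ hg
    simp only [Expr.eval, Op.eval, h6, h.r0, Nat.cast_lt] at hg
    have hin : i < n := by
      by_contra hc; simp [hc] at hg
    refine Runs.of_wp (by simp [resetStep, Simple, Expr.SmallConsts]) hK h.bdd
      (hpow _ (by unfold exponent; omega)) ?_
    have e5 := h.a5 ⟨i, hin⟩
    have e7 := h.a7 ⟨i, hin⟩
    have e4 := hu ⟨i, hin⟩
    simp only [lt_irrefl, if_false] at e4 e5 e7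
    unfold resetStep
    refine wp_seq (wp_write (j := i) trivial h6 ⟨trivial, by simp [Expr.eval, h6]⟩
      (by simp [Expr.eval, h6]; exact e5) ?_)
    refine wp_seq (wp_write (j := i) trivial h6 ⟨trivial, by simp [Expr.eval, h6]⟩
      (by simp [Expr.eval, h6]; exact e7) (wp_seq ?_))
    set s₂ := (s'.setArr 9 i (lastKey g.src ⟨i, hin⟩ g.m)).setArr 10 i (lastKey g.dst ⟨i, hin⟩ g.m)
      with hs₂
    have hlast : ∀ (key : ℕ → Fin n) u, ((lastKey key u g.m : ℕ) : ℤ).natAbs ≤ K := fun key u =>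
      (lastKey_le key u g.m).trans hm
    have hbase : g.Base K s₂ :=
      (h.setArr (by norm_num) i (hlast _ _)).setArr (by norm_num) i (hlast _ _)
    have h46 : s₂.reg 6 = i := h6
    have h44 : s₂.arr 4 i = encodeEnergy (f ⟨i, hin⟩) := by rw [hs₂]; simpa using e4
    -- The common end of both branches: an infinite energy is kept, a finite one is doubled.
    have hfin : ∀ s₃ : State, g.Base K s₃ → s₃.reg = s₂.reg → (∀ b ≠ 4, s₃.arr b = s₂.arr b) →
        s₃.arr 4 i = encodeEnergy (2 * f ⟨i, hin⟩) → (∀ j ≠ i, s₃.arr 4 j = s₂.arr 4 j) →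
        (assign 6 (plus rI (.const 1))).wp s₃ fun s' => ∃ i', (i' ≤ n ∧ g.Base K s' ∧
          s'.reg 5 = B ∧ s'.reg 9 = (g.M / B : ℕ) ∧
          s'.reg 6 = (i' : ℕ) ∧ ∀ u : Fin n, if u.1 < i' then s'.arr 4 u = encodeEnergy (2 * f u) ∧
            s'.arr 9 u = lastKey g.src u g.m ∧ s'.arr 10 u = lastKey g.dst u g.m
          else s'.arr 4 u = encodeEnergy (f u)) ∧ n - i' < n - i := by
      intro s₃ hb3 hr3 ha3 h3 h3'
      refine wp_assign ⟨trivial, trivial⟩ (z := ((i + 1 : ℕ) : ℤ))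
        (by simp [Expr.eval, Op.eval, hr3, h46])
        ⟨i + 1, ⟨hin, hb3.setReg (by norm_num) (by omega), ?_, ?_, by simp, fun u => ?_⟩, by omega⟩
      · simp [hr3, hs₂, h5]
      · simp [hr3, hs₂, h9]
      · rw [State.setReg_arr, ha3 9 (by norm_num), ha3 10 (by norm_num)]
        have := hu u
        by_cases hui : (u : ℕ) = i
        · have hui' : u = ⟨i, hin⟩ := Fin.ext hui
          subst hui'
          rw [if_pos (Nat.lt_succ_self _)]
          exact ⟨h3, by simp [hs₂], by simp [hs₂]⟩
        · rw [h3' _ hui]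
          by_cases hlt : (u : ℕ) < i
          · rw [if_pos hlt] at this
            rw [if_pos (by omega)]
            simpa [hs₂, hui] using this
          · rw [if_neg hlt] at this
            rw [if_neg (by omega)]
            simpa [hs₂, hui] using this
    by_cases htop : f ⟨i, hin⟩ = ⊤
    · refine wp_ite_pos ⟨⟨trivial, by simp [Expr.eval, h46]⟩, trivial⟩ ?_ ?_
      · simp [Expr.eval, Op.eval, h46, h44, htop, encodeEnergy_top]
      · refine hfin s₂ hbase rfl (fun _ _ => rfl) ?_ fun _ _ => rfl
        rw [h44, htop, ENat.mul_top (by norm_num)]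
    · obtain ⟨x, hx⟩ := ENat.ne_top_iff_exists.1 htop
      have h2x : 2 * f ⟨i, hin⟩ = ((2 * x : ℕ) : ℕ∞) := by rw [← hx]; push_cast; rfl
      have h2K : 2 * x ≤ K := by
        have := (hf ⟨i, hin⟩).resolve_left (by rw [h2x]; exact ENat.natCast_ne_top _)
        rw [h2x] at this
        exact_mod_cast this
      rw [← hx, encodeEnergy_coe] at h44
      refine wp_ite_neg ⟨⟨trivial, by simp [Expr.eval, h46]⟩, trivial⟩ ?_ ?_
      · simp [Expr.eval, Op.eval, h46, h44]
      · refine wp_write (j := i) (z := ((2 * x : ℕ) : ℤ)) trivial h46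
          ⟨trivial, trivial, by simp [Expr.eval, h46]⟩ ?_ ?_
        · simp [Expr.eval, Op.eval, h46, h44]
        · refine hfin _ (hbase.setArr (by norm_num) i (by omega)) rfl (fun b hb => ?_) ?_ fun j hj => ?_
          · funext j; simp [hb]
          · rw [h2x, encodeEnergy_coe]; simp
          · simp [hj]
  · obtain ⟨h1, h2, h3, h4, h5⟩ := hs₁
    exact ⟨Nat.zero_le _, h1, h2, h3, h4, fun u => by simpa using h5 u⟩
  · obtain ⟨i, ⟨hi, h, h5, h9, h6, hu⟩, hg⟩ := hs₂
    simp only [Expr.eval, Op.eval, h6, h.r0, Nat.cast_lt] at hg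
    have hin : i = n := by
      by_contra hc
      have : i < n := by omega
      simp [this] at hg
    subst hin
    refine Runs.of_wp (by simp [resetDone, Simple, Expr.SmallConsts]) hK h.bdd
      (hpow _ (by simp [resetDone, degree, Expr.cost, exponent]; omega)) ?_
    unfold resetDone
    refine wp_seq (wp_assign trivial h.r0 (wp_assign trivial rfl ?_))
    refine ⟨(h.setReg (by norm_num) (by omega)).setReg (by norm_num) (by simp [Expr.eval]), by simp [h5],
      by simp [IterData.start], by simp [IterData.start, Expr.eval], by simp [h9], fun u => ?_,
      fun u => ?_, fun j hj => ?_⟩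
    · have := hu u
      rw [if_pos u.2] at this
      exact this.1
    · have := hu u
      rw [if_pos u.2] at this
      exact this.2.1
    · have hj' : j < i := hj
      have := hu ⟨j, hj'⟩
      rw [if_pos hj'] at this
      simp only [IterData.start, hj', dif_pos]
      exact this.2.2
  · simp only [resetInit, resetStep, resetDone, maxCost, Expr.cost]
    omega

/-! ### A step of value iteration -/

lemma satExpr_spec {K B : ℕ} {a : IterData.Run n} {s : State} (E : Fin n → ℕ∞)
    (hs : g.Rep K B a s) (hc : a.cur ≠ 0) (hcm : a.cur ≤ g.m)
    (hu : s.reg 10 = (g.src (a.cur - 1) : ℕ)) (hv : s.reg 11 = (g.dst (a.cur - 1) : ℕ)) :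
    satExpr.NonnegReads s ∧ (satExpr.eval s ≠ 0 ↔ (g.iterData B E).Sat a.f a.cur) := by
  have e1 : ((a.cur : ℤ) - 1).toNat = a.cur - 1 := by omega
  simp only [satExpr, Expr.NonnegReads, Expr.eval, Op.eval, hu, hv, hs.r8, hs.r5, Int.toNat_natCast,
    hs.a4, e1, hs.a3 (a.cur - 1) (by omega)]
  refine ⟨by simp; omega, ?_⟩
  change _ ↔ GameGraph.EdgeSat a.f (g.src (a.cur - 1)) (g.dst (a.cur - 1))
    (0 - (0 - g.wt (a.cur - 1)) / (B : ℤ))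
  generalize (0 - (0 - g.wt (a.cur - 1)) / (B : ℤ)) = z
  unfold GameGraph.EdgeSat
  by_cases h1 : a.f (g.src (a.cur - 1)) = ⊤
  · simp only [h1, encodeEnergy_top, true_or, iff_true]
    rw [if_pos (by norm_num : (-1 : ℤ) < 0)]
    split_ifs <;> norm_num
  obtain ⟨x, hx⟩ := ENat.ne_top_iff_exists.1 h1
  by_cases h2 : a.f (g.dst (a.cur - 1)) = ⊤
  · simp [h2, ← hx, encodeEnergy_top, encodeEnergy_coe]
  obtain ⟨y, hy⟩ := ENat.ne_top_iff_exists.1 h2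
  have hx0 : ¬ (x : ℤ) < 0 := by omega
  simp [← hx, ← hy, encodeEnergy_coe, hx0]

/-! The representation follows the changes of the memory. -/

lemma Rep.setReg_temp {K B : ℕ} {a : IterData.Run n} {s : State} (hs : g.Rep K B a s) {x : ℕ}
    (hx : 10 ≤ x) {z : ℤ} (hz : z.natAbs ≤ K) : g.Rep K B a (s.setReg x z) := by
  refine ⟨hs.toBase.setReg (by omega) hz, ?_, ?_, ?_, ?_, hs.a4, hs.a9, hs.a10⟩
  all_goals rw [State.setReg_reg, if_neg (by omega)]
  exacts [hs.r5, hs.r7, hs.r8, hs.r9]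

lemma Rep.setCur {K B : ℕ} {a : IterData.Run n} {s : State} (hs : g.Rep K B a s) {c : ℕ}
    (hc : c ≤ K) : g.Rep K B { a with cur := c } (s.setReg 8 c) := by
  refine ⟨hs.toBase.setReg (by norm_num) (by omega), ?_, ?_, ?_, ?_, hs.a4, hs.a9, hs.a10⟩
  · simp [hs.r5]
  · simp [hs.r7]
  · simp
  · simp [hs.r9]

lemma Rep.pop {K B : ℕ} {a : IterData.Run n} {s : State} (hs : g.Rep K B a s) {k : ℕ}
    (hk : k ≤ a.sp) (hkK : k ≤ K) : g.Rep K B { a with sp := k } (s.setReg 7 k) := by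
  refine ⟨hs.toBase.setReg (by norm_num) (by omega), ?_, ?_, ?_, ?_, hs.a4, hs.a9,
    fun j hj => hs.a10 j (lt_of_lt_of_le hj hk)⟩
  · simp [hs.r5]
  · simp
  · simp [hs.r8]
  · simp [hs.r9]

lemma Rep.setF {K B : ℕ} {a : IterData.Run n} {s : State} (hs : g.Rep K B a s) (u : Fin n) {x : ℕ∞}
    (hx : (encodeEnergy x).natAbs ≤ K) :
    g.Rep K B { a with f := Function.update a.f u x } (s.setArr 4 u (encodeEnergy x)) := by
  refine ⟨hs.toBase.setArr (by norm_num) _ hx, hs.r5, hs.r7, hs.r8, hs.r9, fun v => ?_, fun v => ?_,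
    fun j hj => ?_⟩
  · by_cases hv : v = u
    · simp [hv]
    · have : (v : ℕ) ≠ u := fun h => hv (Fin.ext h)
      simp [hv, this, hs.a4]
  · simp [hs.a9]
  · simpa using hs.a10 j hj

lemma Rep.setPtr {K B : ℕ} {a : IterData.Run n} {s : State} (hs : g.Rep K B a s) (u : Fin n) {x : ℕ}
    (hx : x ≤ K) : g.Rep K B { a with ptr := Function.update a.ptr u x } (s.setArr 9 u x) := by
  refine ⟨hs.toBase.setArr (by norm_num) _ (by omega), hs.r5, hs.r7, hs.r8, hs.r9, fun v => ?_,
    fun v => ?_, fun j hj => ?_⟩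
  · simp [hs.a4]
  · by_cases hv : v = u
    · simp [hv]
    · have : (v : ℕ) ≠ u := fun h => hv (Fin.ext h)
      simp [hv, this, hs.a9]
  · simpa using hs.a10 j hj

lemma Rep.setStk {K B : ℕ} {a : IterData.Run n} {s : State} (hs : g.Rep K B a s) (i : ℕ) {x : ℕ}
    (hx : x ≤ K) : g.Rep K B { a with stk := Function.update a.stk i x } (s.setArr 10 i x) := by
  refine ⟨hs.toBase.setArr (by norm_num) _ (by omega), hs.r5, hs.r7, hs.r8, hs.r9, fun v => ?_,
    fun v => ?_, fun j hj => ?_⟩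
  · simp [hs.a4]
  · simp [hs.a9]
  · by_cases hji : j = i
    · simp [hji]
    · simpa [hji] using hs.a10 j hj

lemma Rep.push {K B : ℕ} {a : IterData.Run n} {s : State} (hs : g.Rep K B a s) {x : ℕ}
    (hx : x ≤ K) (hsp : a.sp + 1 ≤ K) :
    g.Rep K B { a with stk := Function.update a.stk a.sp x, sp := a.sp + 1 }
      ((s.setArr 10 a.sp x).setReg 7 ((a.sp + 1 : ℕ) : ℤ)) := by
  have h := hs.setStk a.sp hx
  refine ⟨h.toBase.setReg (by norm_num) (by omega), ?_, ?_, ?_, ?_, h.a4, h.a9, fun j hj => ?_⟩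
  · simp [hs.r5]
  · simp
  · simp [hs.r8]
  · simp [hs.r9]
  · by_cases hji : j = a.sp
    · simp [hji]
    · have hj' : j < a.sp + 1 := hj
      simpa [hji] using hs.a10 j (by omega)

lemma wp_liftProg {K B : ℕ} (hK : 1 ≤ K) {a : IterData.Run n} {s : State} (E : Fin n → ℕ∞)
    (hs : g.Rep K B a s) {u : Fin n} (hu : s.reg 10 = (u : ℕ)) (hf : a.f u ≠ ⊤) (hm : g.m ≤ K)
    (hM : g.M ≤ K) (hsp : a.sp + 1 ≤ K) {R : State → Prop}
    (hR : ∀ s', g.Rep K B { a with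
        f := Function.update a.f u ((g.iterData B E).raise (a.f u))
        stk := Function.update a.stk a.sp (lastKey g.dst u g.m)
        sp := a.sp + 1 } s' → s'.reg 10 = (u : ℕ) → R s') :
    liftProg.wp s R := by
  obtain ⟨x, hx⟩ := ENat.ne_top_iff_exists.1 hf
  have h4 := hs.a4 u
  rw [← hx, encodeEnergy_coe] at h4
  have hr : (Expr.read 4 rU).NonnegReads s := ⟨trivial, by simp [Expr.eval, hu]⟩
  have hpush : ∀ s₁, g.Rep K B { a with
      f := Function.update a.f u ((g.iterData B E).raise (a.f u)) } s₁ → s₁.reg 10 = (u : ℕ) →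
      (seq (write 10 rSp (.read 7 rU)) (assign 7 (plus rSp (.const 1)))).wp s₁ R := by
    intro s₁ h1 hu1
    refine wp_seq (wp_write (j := a.sp) (z := (lastKey g.dst u g.m : ℕ)) trivial h1.r7
      ⟨trivial, by simp [Expr.eval, hu1]⟩ (by simp [Expr.eval, hu1, h1.a7]) ?_)
    refine wp_assign (z := ((a.sp + 1 : ℕ) : ℤ)) ⟨trivial, trivial⟩
      (by simp [Expr.eval, Op.eval, h1.r7]) ?_
    exact hR _ (h1.push ((lastKey_le _ _ _).trans hm) hsp) (by simp [hu1])
  unfold liftProg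
  refine wp_seq ?_
  have hcapM : g.M / B ≤ K := (Nat.div_le_self _ _).trans hM
  by_cases hlt : x < g.M / B
  · have hraise : (g.iterData B E).raise (a.f u) = ((x + 1 : ℕ) : ℕ∞) := by
      rw [← hx, IterData.raise, if_pos]
      · push_cast; rfl
      · change (x : ℕ∞) + 1 ≤ ((g.M / B : ℕ) : ℕ∞)
        exact_mod_cast hlt
    refine wp_ite_pos ⟨hr, trivial⟩ ?_ ?_
    · simp only [Expr.eval, Op.eval, hu, Int.toNat_natCast, h4, hs.r9]
      rw [if_pos (by exact_mod_cast hlt)]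
      norm_num
    · refine wp_write (j := u) (z := encodeEnergy ((g.iterData B E).raise (a.f u))) trivial hu
        ⟨hr, trivial⟩ ?_ ?_
      · rw [hraise, encodeEnergy_coe]
        simp [Expr.eval, Op.eval, hu, h4]
      · refine hpush _ (hs.setF u ?_) hu
        rw [hraise, encodeEnergy_coe]
        omega
  · have hraise : (g.iterData B E).raise (a.f u) = ⊤ := by
      rw [← hx, IterData.raise, if_neg]
      change ¬ (x : ℕ∞) + 1 ≤ ((g.M / B : ℕ) : ℕ∞)
      exact_mod_cast hlt
    refine wp_ite_neg ⟨hr, trivial⟩ ?_ ?_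
    · simp only [Expr.eval, Op.eval, hu, Int.toNat_natCast, h4, hs.r9]
      rw [if_neg (by exact_mod_cast hlt)]
    · refine wp_write (j := u) (z := encodeEnergy ((g.iterData B E).raise (a.f u))) trivial hu
        trivial ?_ ?_
      · rw [hraise, encodeEnergy_top]; rfl
      · refine hpush _ (hs.setF u ?_) hu
        rw [hraise, encodeEnergy_top]
        simpa using hK

lemma wp_checkEdge {K B : ℕ} (hK : 2 ≤ K) (hn : n ≤ K) (hm : g.m ≤ K) (hM : g.M ≤ K)
    {E : Fin n → ℕ∞} (hd : (g.iterData B E).Valid) {a : IterData.Run n}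
    {s : State} (hs : g.Rep K B a s) (ha : (g.iterData B E).Inv a)
    (hpot : (g.iterData B E).potential a ≤ K) (hc : a.cur ≠ 0) :
    checkEdge.wp s fun s' => ∃ a', g.Rep K B a' s' ∧ (g.iterData B E).Inv a' ∧
      (g.iterData B E).potential a' < (g.iterData B E).potential a := by
  have hcm : a.cur ≤ g.m := ha.cur_le
  have e1 : ((a.cur : ℤ) - 1).toNat = a.cur - 1 := by omega
  set u := g.src (a.cur - 1) with hu
  set v := g.dst (a.cur - 1) with hv
  unfold checkEdge
  refine wp_seq (wp_assign (z := (u : ℕ)) ⟨⟨trivial, trivial⟩, ?_⟩ ?_ ?_)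
  · simp only [Expr.eval, Op.eval, hs.r8]; omega
  · simp only [Expr.eval, Op.eval, hs.r8, e1]; exact hs.a1 _ (by omega)
  refine wp_seq (wp_assign (z := (v : ℕ)) ⟨⟨trivial, trivial⟩, ?_⟩ ?_ ?_)
  · simp [Expr.eval, Op.eval, hs.r8]; omega
  · simp [Expr.eval, Op.eval, hs.r8, e1]; exact hs.a2 _ (by omega)
  have hr : g.Rep K B a ((s.setReg 10 (u : ℕ)).setReg 11 (v : ℕ)) :=
    (hs.setReg_temp (by norm_num) (by have := u.2; omega)).setReg_temp (by norm_num)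
      (by have := v.2; omega)
  have hru : ((s.setReg 10 (u : ℕ)).setReg 11 (v : ℕ)).reg 10 = (u : ℕ) := by simp
  have hrv : ((s.setReg 10 (u : ℕ)).setReg 11 (v : ℕ)).reg 11 = (v : ℕ) := by simp
  generalize (s.setReg 10 (u : ℕ)).setReg 11 (v : ℕ) = s₁ at hr hru hrv
  obtain ⟨hsr, hsat⟩ := satExpr_spec E hr hc hcm hru hrv
  by_cases hS : (g.iterData B E).Sat a.f a.cur
  · refine wp_ite_pos hsr (hsat.2 hS) (wp_assign trivial rfl ?_)
    exact ⟨_, hr.setCur (c := 0) (Nat.zero_le _), ha.discard hc (Or.inl hS)⟩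
  refine wp_ite_neg hsr (not_not.1 fun h => hS (hsat.1 h)) ?_
  have hfu : a.f u ≠ ⊤ := fun h => hS (Or.inl h)
  have hlift : (u ∈ g.VA → a.ptr u = a.cur ∧ lastKey g.src u (a.cur - 1) = 0) →
      ∀ a' : IterData.Run n, a' = ⟨Function.update a.f u ((g.iterData B E).raise (a.f u)),
        if u ∈ g.VA then Function.update a.ptr u (lastKey g.src u g.m) else a.ptr,
        Function.update a.stk a.sp (lastKey g.dst u g.m), a.sp + 1,
        if u ∈ g.VA then lastKey g.src u g.m else a.cur⟩ →
      (g.iterData B E).Inv a' ∧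
        (g.iterData B E).potential a' < (g.iterData B E).potential a := by
    rintro hA a' rfl
    exact ha.lift hd hc hS hu.symm hA rfl rfl rfl rfl rfl
  -- The new stack pointer fits since it is below the potential after the step, which is smaller
  -- than the present one.
  have hsp : ∀ a' : IterData.Run n, a'.sp = a.sp + 1 →
      (g.iterData B E).potential a' < (g.iterData B E).potential a → a.sp + 1 ≤ K := by
    intro a' h1 h2
    have := IterData.sp_le_potential (d := g.iterData B E) a'
    omega
  have hr0 : (Expr.read 0 rU).NonnegReads s₁ := ⟨trivial, by simp [Expr.eval, hru]⟩
  have h0 : (Expr.read 0 rU).eval s₁ = if u ∈ g.VA then 1 else 0 := by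
    simp [Expr.eval, hru, hr.a0]
  by_cases huA : u ∈ g.VA
  · refine wp_ite_pos hr0 (by simp [h0, huA]) ?_
    have hr9 : (Expr.read 9 rU).NonnegReads s₁ := ⟨trivial, by simp [Expr.eval, hru]⟩
    have h9 : (Expr.op .eq (.read 9 rU) rCur).eval s₁ = if a.ptr u = a.cur then 1 else 0 := by
      simp [Expr.eval, Op.eval, hru, hr.a9, hr.r8]
    by_cases hp : a.ptr u = a.cur
    · refine wp_ite_pos ⟨hr9, trivial⟩ (by simp [h9, hp]) ?_
      have hr6 : (Expr.read 6 rCur).NonnegReads s₁ := ⟨trivial, by simp [Expr.eval, hr.r8]⟩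
      have h6 : (Expr.read 6 rCur).eval s₁ = (lastKey g.src u (a.cur - 1) : ℕ) := by
        simp only [Expr.eval, hr.r8, Int.toNat_natCast]
        exact hr.a6 a.cur (by omega) hcm
      by_cases hnx : lastKey g.src u (a.cur - 1) = 0
      · refine wp_ite_neg hr6 (by simp [h6, hnx]) (wp_seq ?_)
        obtain ⟨hi, hpt⟩ := hlift (fun _ => ⟨hp, hnx⟩) _ rfl
        refine wp_liftProg (by omega) E hr hru hfu hm hM (hsp _ rfl hpt) fun s₂ h2 hu2 => ?_
        have hl : lastKey g.src u g.m ≤ K := (lastKey_le _ _ _).trans hm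
        refine wp_seq (wp_assign (z := (lastKey g.src u g.m : ℕ))
          ⟨trivial, by simp [Expr.eval, hu2]⟩ (by simp [Expr.eval, hu2, h2.a5]) ?_)
        refine wp_write (j := u) (z := (lastKey g.src u g.m : ℕ)) trivial
          (by simp [Expr.eval, hu2]) trivial (by simp [Expr.eval]) ?_
        simp only [huA, if_true] at hi hpt
        exact ⟨_, (h2.setCur hl).setPtr u hl, hi, hpt⟩
      · refine wp_ite_pos hr6 (by simpa [h6] using hnx) ?_
        have hl : lastKey g.src u (a.cur - 1) ≤ K := (lastKey_le _ _ _).trans (by omega)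
        refine wp_seq (wp_assign hr6 h6 ?_)
        refine wp_write (j := u) (z := (lastKey g.src u (a.cur - 1) : ℕ)) trivial
          (by simp [Expr.eval, hru]) trivial (by simp [Expr.eval]) ?_
        exact ⟨_, (hr.setCur hl).setPtr u hl, ha.advance hc hS hu.symm huA hp hnx rfl⟩
    · refine wp_ite_neg ⟨hr9, trivial⟩ (by simp [h9, hp]) (wp_assign trivial rfl ?_)
      exact ⟨_, hr.setCur (c := 0) (Nat.zero_le _), ha.discard hc (Or.inr ⟨huA, hp⟩)⟩
  · refine wp_ite_neg hr0 (by simp [h0, huA]) ?_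
    obtain ⟨hi, hpt⟩ := hlift (fun h => (huA h).elim) _ rfl
    refine wp_liftProg (by omega) E hr hru hfu hm hM (hsp _ rfl hpt) fun s₂ h2 _ => ?_
    simp only [huA, if_false] at hi hpt
    exact ⟨_, h2, hi, hpt⟩

lemma wp_popEdge {K B : ℕ} (hm : g.m ≤ K) {E : Fin n → ℕ∞} {a : IterData.Run n}
    {s : State} (hs : g.Rep K B a s) (ha : (g.iterData B E).Inv a)
    (hpot : (g.iterData B E).potential a ≤ K) (hc : a.cur = 0) (hsp : a.sp ≠ 0) :
    popEdge.wp s fun s' => ∃ a', g.Rep K B a' s' ∧ (g.iterData B E).Inv a' ∧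
      (g.iterData B E).potential a' < (g.iterData B E).potential a := by
  obtain ⟨k, hk⟩ := Nat.exists_eq_succ_of_ne_zero hsp
  have hkK : k ≤ K := by
    have := IterData.sp_le_potential (d := g.iterData B E) a
    omega
  have e1 : s.reg 7 - 1 = (k : ℤ) := by rw [hs.r7, hk]; push_cast; ring
  have htop : (Expr.read 10 (minus rSp (.const 1))).NonnegReads s :=
    ⟨⟨trivial, trivial⟩, by simp [Expr.eval, Op.eval, e1]⟩
  have htop' : (Expr.read 10 (minus rSp (.const 1))).eval s = (a.stk k : ℕ) := by
    simp only [Expr.eval, Op.eval, e1, Int.toNat_natCast]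
    exact hs.a10 k (by omega)
  have hstk : a.stk k ≤ g.m := ha.stk_le k (by omega)
  unfold popEdge
  by_cases h0 : a.stk k = 0
  · refine wp_ite_neg htop (by simp [htop', h0]) (wp_assign (z := (k : ℕ)) ⟨trivial, trivial⟩ e1 ?_)
    exact ⟨_, hs.pop (by omega) hkK, ha.pop hc hk h0⟩
  · refine wp_ite_pos htop (by simpa [htop'] using h0) (wp_seq (wp_assign htop htop' ?_))
    refine wp_write (j := k) (z := (lastKey g.dst (g.dst (a.stk k - 1)) (a.stk k - 1) : ℕ))
      ⟨trivial, trivial⟩ (by simp [Expr.eval, Op.eval, e1]) ⟨trivial, by simp [Expr.eval]⟩ ?_ ?_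
    · simpa [Expr.eval] using hs.a8 (a.stk k) (by omega) hstk
    · exact ⟨_, (hs.setCur (hstk.trans hm)).setStk k ((lastKey_le _ _ _).trans (by omega)),
        ha.take hc hk h0 rfl⟩

/-! ### A phase -/

/-- The initial potential bounds the number of rounds. By `hrK` it is at most `K`, which also keeps
the stack pointer within the memory bound. -/
lemma runs_phase {K β B r : ℕ} (hK : 2 ≤ K) (hn : n ≤ K) (hm : g.m ≤ K) (hM : g.M ≤ K)
    (hβ : K ^ exponent ≤ β) {E : Fin n → ℕ∞} (hd : (g.iterData B E).Valid) {f : Fin n → ℕ∞}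
    (hle : ∀ u, 2 * f u ≤ E u) (hcap : ∀ u, 2 * f u = ⊤ ∨ 2 * f u ≤ (g.M / B : ℕ))
    (hr : ∀ u, (g.iterData B E).rank (E u) ≤ (g.iterData B E).rank (2 * f u) + r)
    (hrK : (r + 1) * (3 * g.m + 2 * n) ≤ K) {s : State} (hs : g.Base K s) (h5 : s.reg 5 = B)
    (h4 : ∀ u : Fin n, s.arr 4 u = encodeEnergy (f u)) :
    Runs β phase s (60 * (n + 1) +
        ((r + 1) * (3 * g.m + 2 * n) + 1) * (iterStep.maxCost + 4)) fun s' =>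
      g.Base K s' ∧ s'.reg 5 = B ∧ ∀ u : Fin n, s'.arr 4 u = encodeEnergy (E u) := by
  have hpow : ∀ c, c ≤ exponent → K ^ c ≤ β := fun c hc =>
    (Nat.pow_le_pow_right (by omega) hc).trans hβ
  have hpot := IterData.potential_start_le hr
  refine (runs_reset hK hn hm hM hβ (fun u => (hcap u).imp_right fun h => h.trans ?_) hs h5 h4 E).seq
    fun s₁ h1 => (Runs.while_of_potential (I := fun a s' => g.Rep K B a s' ∧
      (g.iterData B E).Inv a ∧ (g.iterData B E).potential a ≤ K) (g.iterData B E).potential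
      iterStep.maxCost ?_ ?_ _ s₁ ⟨h1, IterData.inv_start hd hle hcap, hpot.trans hrK⟩).mono ?_ ?_
  · rintro a s' ⟨h, -⟩
    exact (Expr.eval_le_and_legal hK h.bdd (plus rCur rSp) (by simp [Expr.NonnegReads])
      (by simp [Expr.SmallConsts])).2 β (hpow _ (by simp [Expr.cost, exponent]; omega))
  · rintro a s' ⟨h, hi, hp⟩ hg
    have hg' : a.cur + a.sp ≠ 0 := by
      simp only [Expr.eval, Op.eval, h.r7, h.r8] at hg
      omega
    refine (Runs.of_wp (R := fun s' => ∃ a', g.Rep K B a' s' ∧ (g.iterData B E).Inv a' ∧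
      (g.iterData B E).potential a' < (g.iterData B E).potential a) (by simp [iterStep, checkEdge,
        popEdge, liftProg, satExpr, Simple, Expr.SmallConsts]) hK h.bdd
      (hpow _ (by unfold exponent; omega)) ?_).mono le_rfl ?_
    · by_cases hc : a.cur = 0
      · exact wp_ite_neg trivial (by simp [Expr.eval, h.r8, hc])
          (wp_popEdge hm h hi hp hc (by omega))
      · exact wp_ite_pos trivial (by simpa [Expr.eval, h.r8] using hc)
          (wp_checkEdge hK hn hm hM hd h hi hp hc)
    · rintro s'' ⟨a', h1, h2, h3⟩
      exact ⟨a', ⟨h1, h2, h3.le.trans hp⟩, h3⟩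
  · have h2 := Nat.mul_le_mul_right (iterStep.maxCost + 4) hpot
    simp only [Expr.cost] at h2 ⊢
    change _ ≤ (r + 1) * (3 * g.m + 2 * n) * _ at h2
    rw [add_mul ((r + 1) * _), show iterStep.maxCost + (1 + 1 + 1) + 1 = iterStep.maxCost + 4 by omega]
    omega
  · rintro s' ⟨a, ⟨h, hi, -⟩, hg⟩
    have hg' : a.cur = 0 ∧ a.sp = 0 := by
      simp only [Expr.eval, Op.eval, h.r7, h.r8] at hg
      omega
    refine ⟨h.toBase, h.r5, fun u => ?_⟩
    rw [h.a4, hi.eq_of_done hd hg'.1 hg'.2]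
    rfl
  · exact_mod_cast (Nat.div_le_self _ _).trans hM

end EdgeListGame

namespace EdgeListGame

open WordRAM Prog EnergyProgram

variable {n : ℕ} {g : EdgeListGame n}

/-! ### The sequence of the units -/

lemma runs_chooseUnit {K β J : ℕ} (hK : 2 ≤ K) (hp : g.p ≤ K) (hq : 0 < g.q)
    (hβ : K ^ exponent ≤ β)
    (hJ : ∀ j < J, 2 ^ (j + 1) * g.q ≤ g.p ∧ 2 ^ (j + 1) * (2 * n) ≤ g.M)
    (hJ' : ¬ (2 ^ (J + 1) * g.q ≤ g.p ∧ 2 ^ (J + 1) * (2 * n) ≤ g.M)) {s : State}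
    (hs : g.Base K s) (h4 : ∀ i, s.arr 4 i = 0) :
    Runs β chooseUnit s (60 * (J + 1)) fun s' =>
      g.Base K s' ∧ s'.reg 5 = (2 ^ J : ℕ) ∧ ∀ i, s'.arr 4 i = 0 := by
  have hpow : ∀ c, c ≤ exponent → K ^ c ≤ β := fun c hc =>
    (Nat.pow_le_pow_right (by omega) hc).trans hβ
  have hinit : Runs β (assign 5 (.const 1)) s 2 fun s' =>
      g.Base K s' ∧ s'.reg 5 = (2 ^ 0 : ℕ) ∧ ∀ i, s'.arr 4 i = 0 := by
    refine Runs.of_wp (by simp [Simple, Expr.SmallConsts]) hK hs.bdd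
      (hpow _ (by simp [degree, Expr.cost, exponent]; omega)) (wp_assign trivial rfl ?_)
    exact ⟨hs.setReg (by norm_num) (by simp [Expr.eval]; omega), by simp [Expr.eval], h4⟩
  have hguard : ∀ j s', g.Base K s' → s'.reg 5 = (2 ^ j : ℕ) → (unitGuard.eval s' ≠ 0 ↔
      2 ^ (j + 1) * g.q ≤ g.p ∧ 2 ^ (j + 1) * (2 * n) ≤ g.M) := by
    intro j s' h h5
    simp only [unitGuard, Expr.eval, Op.eval, h5, h.r0, h.r2, h.r3, h.r4, Int.lt_add_one_iff]
    have e1 : (2 * ((2 ^ j : ℕ) : ℤ) * g.q ≤ g.p) ↔ 2 ^ (j + 1) * g.q ≤ g.p := by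
      rw [pow_succ']; norm_cast
    have e2 : (2 * ((2 ^ j : ℕ) : ℤ) * (2 * n) ≤ g.M) ↔ 2 ^ (j + 1) * (2 * n) ≤ g.M := by
      rw [pow_succ']; norm_cast
    rw [← e1, ← e2]
    split_ifs <;> simp_all
  refine (hinit.seq fun s₁ hs₁ => Runs.while_of_potential
    (I := fun j s' => j ≤ J ∧ g.Base K s' ∧ s'.reg 5 = (2 ^ j : ℕ) ∧
      ∀ i, s'.arr 4 i = 0) (fun j => J - j) (assign 5 (times (.const 2) rUnit)).maxCost ?_ ?_ 0 s₁
      ⟨Nat.zero_le _, hs₁⟩).mono ?_ ?_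
  · rintro j s' ⟨-, h, -⟩
    exact (Expr.eval_le_and_legal hK h.bdd unitGuard (by simp [unitGuard, Expr.NonnegReads])
      (by simp [unitGuard, Expr.SmallConsts])).2 β
      (hpow _ (by simp [unitGuard, Expr.cost, exponent]; omega))
  · rintro j s' ⟨hj, h, h5, h4⟩ hg
    have hjJ : j < J := by
      refine lt_of_le_of_ne hj ?_
      rintro rfl
      exact hJ' ((hguard j s' h h5).1 hg)
    refine Runs.of_wp (by simp [Simple, Expr.SmallConsts]) hK h.bdd
      (hpow _ (by simp [degree, Expr.cost, exponent]; omega))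
      (wp_assign (z := ((2 ^ (j + 1) : ℕ) : ℤ)) ⟨trivial, trivial⟩ ?_ ?_)
    · simp [Expr.eval, Op.eval, h5, pow_succ']
    · refine ⟨j + 1, ⟨hjJ, h.setReg (by norm_num) ?_, by simp, h4⟩, by omega⟩
      -- The unit stays within `K` because the guard gives `2 ^ (j + 1) ≤ 2 ^ (j + 1) * q ≤ p`.
      have := (hJ j hjJ).1
      have := Nat.le_mul_of_pos_right (2 ^ (j + 1)) hq
      rw [Int.natAbs_natCast]
      omega
  · simp only [unitGuard, maxCost, Expr.cost]
    omega
  · rintro s' ⟨j, ⟨hj, h, h5, h4⟩, hg⟩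
    have : j = J := by
      by_contra hne
      exact (hguard j s' h h5).2 (hJ j (by omega)) hg
    subst this
    exact ⟨h, h5, h4⟩

/-- How the energies for the rounded weights are related. -/
structure Energies (g : EdgeListGame n) (J : ℕ) (E : ℕ → Fin n → ℕ∞) : Prop where
  valid : ∀ j ≤ J, (g.iterData (2 ^ j) (E j)).Valid
  two_mul_le : ∀ j u, 2 * E (j + 1) u ≤ E j u
  le_two_mul : ∀ j < J, ∀ u, ∀ y : ℕ, E (j + 1) u ≤ y → E j u ≤ (2 * (y + n) : ℕ)

/-- The summand 4 pays for the guard of the iteration. -/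
def stepCost : ℕ := iterStep.maxCost + 4

/-- From zero a value climbs at most `M / 2 ^ J + 1` ranks, the last of them being infinity. -/
lemma runs_firstPhase {K β J : ℕ} (hK : 2 ≤ K) (hn : n ≤ K) (hm : g.m ≤ K) (hM : g.M ≤ K)
    (hβ : K ^ exponent ≤ β) {E : ℕ → Fin n → ℕ∞} (hE : g.Energies J E)
    (hrK : (g.M / 2 ^ J + 2) * (3 * g.m + 2 * n) ≤ K) {s : State} (hs : g.Base K s)
    (h5 : s.reg 5 = (2 ^ J : ℕ)) (h4 : ∀ i, s.arr 4 i = 0) :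
    Runs β phase s (60 * (n + 1) + ((g.M / 2 ^ J + 2) * (3 * g.m + 2 * n) + 1) * stepCost)
      fun s' => g.Base K s' ∧ s'.reg 5 = (2 ^ J : ℕ) ∧
        ∀ u : Fin n, s'.arr 4 u = encodeEnergy (E J u) := by
  refine runs_phase (r := g.M / 2 ^ J + 1) hK hn hm hM hβ (hE.valid J le_rfl) (f := fun _ => 0) ?_ ?_
    (fun u => ?_) hrK hs h5 fun u => by rw [h4]; exact (encodeEnergy_coe 0).symm
  · simp
  · simp
  · refine le_trans ?_ (Nat.le_add_left _ _)
    unfold IterData.rank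
    split_ifs with h
    · exact le_rfl
    · have h1 : E J u ≤ ((g.M / 2 ^ J : ℕ) : ℕ∞) := ((hE.valid J le_rfl).cap u).resolve_left h
      obtain ⟨x, hx⟩ := ENat.ne_top_iff_exists.1 h
      rw [← hx] at h1 ⊢
      have h2 : x ≤ g.M / 2 ^ J := by exact_mod_cast h1
      exact h2.trans (Nat.le_succ _)

/-- Infinite values are infinite from the start of a phase, and finite ones rise by at most `2 * n`
above twice the coarser energy. So every halving costs `O(m * n)`. -/
lemma runs_refineLoop {K β J : ℕ} (hK : 2 ≤ K) (hn : n ≤ K) (hm : g.m ≤ K) (hM : g.M ≤ K)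
    (hβ : K ^ exponent ≤ β) {E : ℕ → Fin n → ℕ∞} (hE : g.Energies J E)
    (hrK : (2 * n + 1) * (3 * g.m + 2 * n) ≤ K) {s : State} (hs : g.Base K s)
    (h5 : s.reg 5 = (2 ^ J : ℕ)) (h4 : ∀ u : Fin n, s.arr 4 u = encodeEnergy (E J u)) :
    Runs β refineLoop s (J * (60 * (n + 2) +
        ((2 * n + 1) * (3 * g.m + 2 * n) + 1) * stepCost) + 4)
      fun s' => ∀ u : Fin n, s'.arr 4 u = encodeEnergy (E 0 u) := by
  have hpow : ∀ c, c ≤ exponent → K ^ c ≤ β := fun c hc =>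
    (Nat.pow_le_pow_right (by omega) hc).trans hβ
  have hguard : ∀ (j : ℕ) (s' : State), s'.reg 5 = (2 ^ j : ℕ) →
      ((less (.const 1) rUnit).eval s' ≠ 0 ↔ j ≠ 0) := by
    intro j s' h5
    simp only [Expr.eval, Op.eval, h5]
    rcases Nat.eq_zero_or_pos j with rfl | hj
    · simp
    · have : 1 < 2 ^ j := Nat.one_lt_two_pow hj.ne'
      rw [if_pos (by exact_mod_cast this)]
      simp [hj.ne']
  refine (Runs.while_of_potential (I := fun j s' => j ≤ J ∧ g.Base K s' ∧ s'.reg 5 = (2 ^ j : ℕ) ∧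
    ∀ u : Fin n, s'.arr 4 u = encodeEnergy (E j u)) (fun j => j) (4 + (60 * (n + 1) +
        ((2 * n + 1) * (3 * g.m + 2 * n) + 1) * stepCost)) ?_ ?_ J s
      ⟨le_rfl, hs, h5, h4⟩).mono ?_ ?_
  · rintro j s' ⟨-, h, -⟩
    exact (Expr.eval_le_and_legal hK h.bdd (less (.const 1) rUnit) (by simp [Expr.NonnegReads])
      (by simp [Expr.SmallConsts])).2 β (hpow _ (by simp [Expr.cost, exponent]; omega))
  · rintro j s' ⟨hj, h, h5, h4⟩ hg
    obtain ⟨i, rfl⟩ := Nat.exists_eq_succ_of_ne_zero ((hguard j s' h5).1 hg)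
    have hhalf : Runs β (assign 5 (.op .div rUnit (.const 2))) s' 4 fun s'' =>
        g.Base K s'' ∧ s''.reg 5 = (2 ^ i : ℕ) ∧
          ∀ u : Fin n, s''.arr 4 u = encodeEnergy (E (i + 1) u) := by
      refine Runs.of_wp (by simp [Simple, Expr.SmallConsts]) hK h.bdd
        (hpow _ (by simp [degree, Expr.cost, exponent]; omega))
        (wp_assign (z := ((2 ^ i : ℕ) : ℤ)) ⟨trivial, trivial⟩ ?_ ?_)
      · simp only [Expr.eval, Op.eval, h5]
        rw [Nat.succ_eq_add_one, pow_succ, Nat.cast_mul]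
        exact Int.mul_ediv_cancel _ (by norm_num)
      · refine ⟨h.setReg (by norm_num) ?_, by simp, h4⟩
        have h6 := h.bdd.1 5
        rw [h5, Int.natAbs_natCast] at h6
        exact (Nat.pow_le_pow_right (by norm_num) (Nat.le_succ i)).trans h6
    have hv := hE.valid i (by omega)
    have hfin : ∀ u, ∀ y : ℕ, E (i + 1) u = y → ∃ x : ℕ, E i u = x ∧ x ≤ 2 * y + 2 * n := by
      intro u y hy
      have h1 := hE.le_two_mul i hj u y hy.le
      obtain ⟨x, hx⟩ := ENat.ne_top_iff_exists.1
        (ne_top_of_le_ne_top (ENat.natCast_ne_top _) h1)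
      rw [← hx] at h1
      have h2 : x ≤ 2 * (y + n) := by exact_mod_cast h1
      exact ⟨x, hx.symm, by omega⟩
    refine (hhalf.seq fun s'' ⟨h1, h2, h3⟩ => runs_phase (r := 2 * n) hK hn hm hM hβ hv
      (hE.two_mul_le i) (fun u => ?_) (fun u => ?_) hrK h1 h2 h3).mono le_rfl ?_
    · by_cases htop : E (i + 1) u = ⊤
      · left; rw [htop, ENat.mul_top (by norm_num)]
      · obtain ⟨y, hy⟩ := ENat.ne_top_iff_exists.1 htop
        obtain ⟨x, hx, -⟩ := hfin u y hy.symm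
        right
        refine (hE.two_mul_le i u).trans ((hv.cap u).resolve_left ?_)
        change E i u ≠ ⊤
        rw [hx]
        exact ENat.natCast_ne_top _
    · by_cases htop : E (i + 1) u = ⊤
      · have : E i u = ⊤ := by
          have := hE.two_mul_le i u
          rwa [htop, ENat.mul_top (by norm_num), top_le_iff] at this
        rw [htop, this, ENat.mul_top (by norm_num)]
        omega
      · obtain ⟨y, hy⟩ := ENat.ne_top_iff_exists.1 htop
        obtain ⟨x, hx, hxy⟩ := hfin u y hy.symm
        have h2y : 2 * E (i + 1) u = ((2 * y : ℕ) : ℕ∞) := by rw [← hy]; push_cast; rfl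
        rw [hx, h2y, IterData.rank_coe, IterData.rank_coe]
        exact hxy
    · rintro s'' ⟨h1, h2, h3⟩
      exact ⟨i, ⟨by omega, h1, h2, h3⟩, Nat.lt_succ_self i⟩
  · refine Nat.add_le_add (Nat.mul_le_mul_left _ ?_) le_rfl
    simp only [Expr.cost]
    omega
  · rintro s' ⟨j, ⟨hj, h, h5, h4⟩, hg⟩
    have : j = 0 := not_not.1 fun h0 => (hguard j s' h5).2 h0 hg
    subst this
    exact h4

/-- A constant for the running time of the whole program. -/
def timeConst : ℕ := 20 * stepCost + 1000

/-- Since `n ≤ m`, all terms linear in `n` are absorbed into `m`. The single setup and first phase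
give `m * (M / 2 ^ J + 1)`, the halvings `J * (m * n)`. -/
lemma runs_main {K β J : ℕ} (hn : 0 < n) (hnm : n ≤ g.m) (hK : 2 ≤ K) (hm : g.m ≤ K) (hM : g.M ≤ K)
    (hp : g.p ≤ K) (hq : 0 < g.q) (hβ : K ^ exponent ≤ β)
    (hJ : ∀ j < J, 2 ^ (j + 1) * g.q ≤ g.p ∧ 2 ^ (j + 1) * (2 * n) ≤ g.M)
    (hJ' : ¬ (2 ^ (J + 1) * g.q ≤ g.p ∧ 2 ^ (J + 1) * (2 * n) ≤ g.M))
    {E : ℕ → Fin n → ℕ∞} (hE : g.Energies J E)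
    (hrK : (g.M + 2) * (3 * g.m + 2 * n) ≤ K) (hrK' : (2 * n + 1) * (3 * g.m + 2 * n) ≤ K)
    {s : State} (hs : g.InputRep K s) (h4 : ∀ i, s.arr 4 i = 0) (h5 : ∀ i, s.arr 5 i = 0)
    (h7 : ∀ i, s.arr 7 i = 0) :
    Runs β main s (timeConst * (g.m * (g.M / 2 ^ J + 1) + J * (g.m * n)))
      fun s' => ∀ u : Fin n, s'.arr 4 u = encodeEnergy (E 0 u) := by
  have hrK'' : (g.M / 2 ^ J + 2) * (3 * g.m + 2 * n) ≤ K :=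
    (Nat.mul_le_mul_right _ (Nat.add_le_add_right (Nat.div_le_self _ _) 2)).trans hrK
  have hnK : n ≤ K := hnm.trans hm
  refine ((runs_link hK hm hβ hs h5 h7 h4).seq fun s₁ ⟨h1, h1'⟩ =>
    (runs_chooseUnit hK hp hq hβ hJ hJ' h1 h1').seq fun s₂ ⟨h2, h2', h2''⟩ =>
    (runs_firstPhase hK hnK hm hM hβ hE hrK'' h2 h2' h2'').seq fun s₃ ⟨h3, h3', h3''⟩ =>
    runs_refineLoop hK hnK hm hM hβ hE hrK' h3 h3' h3'').mono ?_ fun _ h => h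
  generalize g.M / 2 ^ J = X
  unfold timeConst
  generalize stepCost = c
  generalize g.m = m at *
  have hmn : m ≤ m * n := Nat.le_mul_of_pos_right m hn
  have hX : m * (X + 1) = m * X + m := by ring
  have e1 : ((X + 2) * (3 * m + 2 * n) + 1) * c ≤ (11 * (m * (X + 1))) * c := by
    refine Nat.mul_le_mul_right c ?_
    have : (X + 2) * (3 * m + 2 * n) ≤ (X + 2) * (5 * m) := Nat.mul_le_mul_left _ (by omega)
    have e : (X + 2) * (5 * m) = 5 * (m * X) + 10 * m := by ring
    omega
  have e2 : ((2 * n + 1) * (3 * m + 2 * n) + 1) * c ≤ (16 * (m * n)) * c := by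
    refine Nat.mul_le_mul_right c ?_
    have : (2 * n + 1) * (3 * m + 2 * n) ≤ (3 * n) * (5 * m) := Nat.mul_le_mul (by omega) (by omega)
    have e : (3 * n) * (5 * m) = 15 * (m * n) := by ring
    omega
  have e3 : J * (60 * (n + 2) + ((2 * n + 1) * (3 * m + 2 * n) + 1) * c) ≤
      J * (180 * (m * n) + 16 * (m * n) * c) := Nat.mul_le_mul_left _ (by omega)
  have e4 : J ≤ J * (m * n) := Nat.le_mul_of_pos_right J (by omega)
  nlinarith [Nat.zero_le (c * (m * (X + 1))), Nat.zero_le (c * (J * (m * n))), Nat.zero_le (m * X)]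

end EdgeListGame

/-! ## The running time -/

/-- The logarithm is natural, and `2 * log 2 ≥ 1`. -/
lemma le_two_mul_log {J : ℕ} {x : ℝ} (h : J ≠ 0 → (2 : ℝ) ^ J ≤ x) :
    (J : ℝ) ≤ 2 * max 0 (Real.log x) := by
  rcases Nat.eq_zero_or_pos J with rfl | hJ
  · simp
  · have h1 := Real.log_le_log (by positivity) (h hJ.ne')
    rw [Real.log_pow] at h1
    have h2 := Real.log_two_gt_d9
    have h3 : (0 : ℝ) ≤ J := Nat.cast_nonneg J
    have h4 := le_max_right 0 (Real.log x)
    nlinarith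

/-- If `D` would allow one more doubling, then `M` forbade it: `M / 2 ^ J ≤ 4 * n`, and `log D ≥ log
2` pays for the resulting `m * n`. Otherwise `⌈D⌉ ≤ 2 ^ (J + 1)`, so `M / 2 ^ J` is at most twice `M
/ ⌈D⌉`. -/
lemma time_le_first {m n M J : ℕ} {D : ℝ} (hJ : J ≠ 0 → (2 : ℝ) ^ J ≤ D)
    (hJ' : (2 : ℝ) ^ (J + 1) ≤ D → (M : ℝ) < 2 ^ (J + 1) * (2 * n)) :
    (m : ℝ) * (M / 2 ^ J + 1) + J * (m * n) ≤
      10 * (m * n * max 0 (Real.log D) + m * (M / ((max 1 ⌈D⌉₊ : ℕ) : ℝ) + 1)) := by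
  have h1 := le_two_mul_log hJ
  set l := max 0 (Real.log D) with hl
  have hl0 : 0 ≤ l := le_max_left _ _
  have hm : (0 : ℝ) ≤ m := Nat.cast_nonneg m
  have hn : (0 : ℝ) ≤ n := Nat.cast_nonneg n
  have hmn : (0 : ℝ) ≤ m * n := by positivity
  have h2 : (J : ℝ) * (m * n) ≤ 2 * l * (m * n) := mul_le_mul_of_nonneg_right h1 hmn
  have hq : (0 : ℝ) ≤ M / ((max 1 ⌈D⌉₊ : ℕ) : ℝ) := by positivity
  have hp : (0 : ℝ) < 2 ^ J := by positivity
  by_cases hD : (2 : ℝ) ^ (J + 1) ≤ D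
  · have h3 : (M : ℝ) / 2 ^ J ≤ 4 * n := by
      rw [div_le_iff₀ hp]
      have := hJ' hD
      rw [pow_succ] at this
      nlinarith
    have h4 : 1 / 2 ≤ l := by
      have h5 : (2 : ℝ) ≤ D := by
        refine le_trans ?_ hD
        calc (2 : ℝ) = 2 ^ 1 := (pow_one _).symm
          _ ≤ _ := pow_le_pow_right₀ (by norm_num) (by omega)
      have h6 := Real.log_le_log (by norm_num) h5
      have h7 := Real.log_two_gt_d9
      have h8 := le_max_right 0 (Real.log D)
      linarith
    have h9 : (m : ℝ) * (M / 2 ^ J) ≤ m * (4 * n) := mul_le_mul_of_nonneg_left h3 hm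
    have h10 : 1 / 2 * ((m : ℝ) * n) ≤ l * (m * n) := mul_le_mul_of_nonneg_right h4 hmn
    have h11 : 0 ≤ (m : ℝ) * (M / ((max 1 ⌈D⌉₊ : ℕ) : ℝ)) := by positivity
    linarith
  · push Not at hD
    have h3 : ((max 1 ⌈D⌉₊ : ℕ) : ℝ) ≤ 2 ^ (J + 1) := by
      have h4 : ⌈D⌉₊ ≤ 2 ^ (J + 1) := by
        rw [Nat.ceil_le]
        push_cast
        exact hD.le
      have h5 : max 1 ⌈D⌉₊ ≤ 2 ^ (J + 1) := max_le Nat.one_le_two_pow h4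
      exact_mod_cast h5
    have h4 : (M : ℝ) / 2 ^ J ≤ 2 * (M / ((max 1 ⌈D⌉₊ : ℕ) : ℝ)) := by
      have h5 : (M : ℝ) / 2 ^ (J + 1) ≤ M / ((max 1 ⌈D⌉₊ : ℕ) : ℝ) := by
        refine div_le_div_of_nonneg_left (by positivity) ?_ h3
        exact_mod_cast lt_of_lt_of_le one_pos (le_max_left 1 ⌈D⌉₊)
      have h6 : (M : ℝ) / 2 ^ (J + 1) = M / 2 ^ J / 2 := by rw [pow_succ, div_div]
      linarith
    have h5 := mul_le_mul_of_nonneg_left h4 hm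
    have h6 : 0 ≤ l * ((m : ℝ) * n) := mul_nonneg hl0 hmn
    have h11 : 0 ≤ (m : ℝ) * (M / ((max 1 ⌈D⌉₊ : ℕ) : ℝ)) := by positivity
    linarith

/-- Here `D < 2 ^ (J + 1)` also forces `M < 2 ^ (J + 1) * (2 * n)`, so the first phase is `O(m * n)`
whichever condition stopped the doubling. -/
lemma time_le_second {m n M J : ℕ} {D : ℝ} (hn : 0 < n) (hJ : J ≠ 0 → (2 : ℝ) ^ J * (2 * n) ≤ M)
    (hJ' : (2 : ℝ) ^ (J + 1) ≤ D → (M : ℝ) < 2 ^ (J + 1) * (2 * n))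
    (hD : (M : ℝ) / (2 * n) ≤ D) :
    (m : ℝ) * (M / 2 ^ J + 1) + J * (m * n) ≤ 10 * (m * n * max 1 (Real.log (M / n))) := by
  have hn' : (1 : ℝ) ≤ n := by exact_mod_cast hn
  have h1 : (J : ℝ) ≤ 2 * max 0 (Real.log (M / n)) := by
    refine le_two_mul_log fun h => ?_
    rw [le_div_iff₀ (by positivity)]
    have := hJ h
    have h2 : (0 : ℝ) < 2 ^ J * n := by positivity
    linarith
  have h2 : max 0 (Real.log ((M : ℝ) / n)) ≤ max 1 (Real.log (M / n)) :=
    max_le_max_right _ zero_le_one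
  set l := max 1 (Real.log ((M : ℝ) / n)) with hl
  have hl1 : 1 ≤ l := le_max_left _ _
  have hm : (0 : ℝ) ≤ m := Nat.cast_nonneg m
  have hmn : (0 : ℝ) ≤ m * n := by positivity
  have hp : (0 : ℝ) < 2 ^ J := by positivity
  have h3 : (M : ℝ) < 2 ^ (J + 1) * (2 * n) := by
    by_cases h : (2 : ℝ) ^ (J + 1) ≤ D
    · exact hJ' h
    · push Not at h
      exact (div_lt_iff₀ (by positivity)).1 (hD.trans_lt h)
  have h4 : (M : ℝ) / 2 ^ J ≤ 4 * n := by
    rw [div_le_iff₀ hp]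
    rw [pow_succ] at h3
    nlinarith
  have h5 : (J : ℝ) * (m * n) ≤ 2 * l * (m * n) := mul_le_mul_of_nonneg_right (by linarith) hmn
  have h6 : (m : ℝ) * (M / 2 ^ J) ≤ m * (4 * n) := mul_le_mul_of_nonneg_left h4 hm
  have h7 : 1 * ((m : ℝ) * n) ≤ l * (m * n) := mul_le_mul_of_nonneg_right hl1 hmn
  have h8 : (m : ℝ) * 1 ≤ m * n := mul_le_mul_of_nonneg_left hn' hm
  linarith

/-! ## The main theorem -/

namespace EdgeListGame

/-! ### Rounding up to multiples of a unit -/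

lemma le_mul_roundUp {B : ℕ} (hB : 0 < B) (z : ℤ) : z ≤ B * roundUp B z := by
  have := Int.mul_ediv_self_le (x := 0 - z) (k := (B : ℤ)) (by omega)
  unfold roundUp
  rw [mul_sub]
  omega

lemma mul_roundUp_lt {B : ℕ} (hB : 0 < B) (z : ℤ) : B * roundUp B z < z + B := by
  have := Int.lt_mul_ediv_self_add (x := 0 - z) (k := (B : ℤ)) (by omega)
  unfold roundUp
  rw [mul_sub]
  omega

lemma roundUp_one (z : ℤ) : roundUp 1 z = z := by
  simp [roundUp]

/-- Rounding for the double unit amounts to halving the already rounded value and rounding up again.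
-/
lemma roundUp_le_two_mul (B : ℕ) (z : ℤ) : roundUp B z ≤ (2 : ℕ) * roundUp (B * 2) z := by
  unfold roundUp
  rw [Nat.cast_mul, ← Int.ediv_ediv_of_nonneg (Int.natCast_nonneg B)]
  generalize (0 - z) / (B : ℤ) = y
  push_cast
  omega

/-! ### The weighted graph as an edge list -/

/-- The weighted graph in the form in which the program uses it. -/
def ofGame {n : ℕ} (hn : 0 < n) (G : GameGraph (Fin n)) (w : Fin n → Fin n → ℤ)
    (L : List (Fin n × Fin n)) (M p q : ℕ) : EdgeListGame n where
  m := L.length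
  M := M
  p := p
  q := q
  src i := (L.getD i (⟨0, hn⟩, ⟨0, hn⟩)).1
  dst i := (L.getD i (⟨0, hn⟩, ⟨0, hn⟩)).2
  wt i := w (L.getD i (⟨0, hn⟩, ⟨0, hn⟩)).1 (L.getD i (⟨0, hn⟩, ⟨0, hn⟩)).2
  VA := G.VA

section

variable {n : ℕ} {hn : 0 < n} {G : GameGraph (Fin n)} {w : Fin n → Fin n → ℤ}
  {L : List (Fin n × Fin n)} {M p q : ℕ}

lemma ofGame_mem (hL : L.toFinset = G.E) {e : ℕ} (h1 : 1 ≤ e) (h2 : e ≤ L.length) :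
    ((ofGame hn G w L M p q).src (e - 1), (ofGame hn G w L M p q).dst (e - 1)) ∈ G.E := by
  rw [← hL, List.mem_toFinset]
  have h : e - 1 < L.length := by omega
  simp only [ofGame, List.getD_eq_getElem _ _ h]
  exact List.getElem_mem h

lemma exists_ofGame (hL : L.toFinset = G.E) {u v : Fin n} (h : (u, v) ∈ G.E) :
    ∃ e, 1 ≤ e ∧ e ≤ L.length ∧ (ofGame hn G w L M p q).src (e - 1) = u ∧
      (ofGame hn G w L M p q).dst (e - 1) = v := by
  rw [← hL, List.mem_toFinset, List.mem_iff_getElem] at h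
  obtain ⟨i, hi, h⟩ := h
  refine ⟨i + 1, by omega, hi, ?_⟩
  simp only [ofGame, Nat.add_sub_cancel, List.getD_eq_getElem _ _ hi, h, and_self]

lemma valid_ofGame (hL : L.toFinset = G.E) {B : ℕ}
    (hcap : ∀ u, G.minEnergy (fun a b => roundUp B (w a b)) u = ⊤ ∨
      G.minEnergy (fun a b => roundUp B (w a b)) u ≤ (M / B : ℕ)) :
    ((ofGame hn G w L M p q).iterData B (G.minEnergy fun a b => roundUp B (w a b))).Valid where
  bob e h1 h2 h3 := G.minEnergy_edgeSat_bob _ h3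
    (ofGame_mem (hn := hn) (w := w) (M := M) (p := p) (q := q) hL h1 h2)
  alice u hu := by
    obtain ⟨v, hv, hs⟩ := G.minEnergy_edgeSat_alice (fun a b => roundUp B (w a b)) hu
    obtain ⟨e, h1, h2, h3, h4⟩ := exists_ofGame (hn := hn) (w := w) (M := M) (p := p) (q := q) hL hv
    subst h3 h4
    exact ⟨e, h1, h2, rfl, hs⟩
  least f hB hA u := by
    refine G.minEnergy_le_of_edgeSat _ f (fun a b ha hab => ?_) (fun a ha => ?_) u
    · obtain ⟨e, h1, h2, h3, h4⟩ :=
        exists_ofGame (hn := hn) (w := w) (M := M) (p := p) (q := q) hL hab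
      subst h3 h4
      exact hB e h1 h2 ha
    · obtain ⟨e, h1, h2, h3, h4⟩ := hA a ha
      subst h3
      exact ⟨_, ofGame_mem (hn := hn) (w := w) (M := M) (p := p) (q := q) hL h1 h2, h4⟩
  cap := hcap

/-- The penalty is known only for `w`, so the comparison of two consecutive units from above passes
through the energies for `w`. -/
lemma energies_ofGame (hL : L.toFinset = G.E) (hM : G.IsEnergyBound w M) {J : ℕ}
    (hJ : ∀ j < J, ((2 ^ (j + 1) : ℕ) : ℝ≥0∞) ≤ G.penalty w) :
    (ofGame hn G w L M p q).Energies J fun j => G.minEnergy fun a b => roundUp (2 ^ j) (w a b) where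
  valid j hj := by
    have hpos : 0 < 2 ^ j := by positivity
    refine valid_ofGame hL fun u => ?_
    rcases hM u with h | h
    · left
      -- The unit one changes nothing and needs no penalty; every larger unit is covered by `hJ`.
      rcases Nat.eq_zero_or_pos j with rfl | hj0
      · simpa [roundUp_one] using h
      · by_contra hne
        obtain ⟨y, hy⟩ := ENat.ne_top_iff_exists.1 hne
        have hB := hJ (j - 1) (by omega)
        rw [Nat.sub_add_cancel hj0] at hB
        have := G.minEnergy_le_mul_add w (fun a b => roundUp (2 ^ j) (w a b)) (2 ^ j)
          (fun a b => mul_roundUp_lt hpos _) hpos hB hy.symm.le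
        rw [h, top_le_iff] at this
        exact ENat.natCast_ne_top _ this
    · right
      exact G.minEnergy_le_div w _ (2 ^ j) hpos (fun a b => le_mul_roundUp hpos _) h
  two_mul_le j u := by
    by_cases htop : G.minEnergy (fun a b => roundUp (2 ^ j) (w a b)) u = ⊤
    · rw [htop]; exact le_top
    · obtain ⟨x, hx⟩ := ENat.ne_top_iff_exists.1 htop
      have h1 := G.minEnergy_le_div (fun a b => roundUp (2 ^ j) (w a b))
        (fun a b => roundUp (2 ^ (j + 1)) (w a b)) 2 two_pos
        (fun a b => by rw [pow_succ]; exact roundUp_le_two_mul _ _) hx.symm.le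
      rw [← hx]
      obtain ⟨y, hy⟩ := ENat.ne_top_iff_exists.1 (ne_top_of_le_ne_top (ENat.natCast_ne_top _) h1)
      rw [← hy] at h1 ⊢
      have h2 : y ≤ x / 2 := by exact_mod_cast h1
      have h3 : 2 * y ≤ x := by omega
      exact_mod_cast h3
  le_two_mul j hj u y hy := by
    have hpos : 0 < 2 ^ j := by positivity
    have hpos' : 0 < 2 ^ (j + 1) := by positivity
    have h1 := G.minEnergy_le_mul_add w (fun a b => roundUp (2 ^ (j + 1)) (w a b)) (2 ^ (j + 1))
      (fun a b => mul_roundUp_lt hpos' _) hpos' (hJ j hj) hy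
    have h2 := G.minEnergy_le_div w (fun a b => roundUp (2 ^ j) (w a b)) (2 ^ j) hpos
      (fun a b => le_mul_roundUp hpos _) h1
    rwa [Fintype.card_fin, pow_succ, mul_assoc, Nat.mul_div_cancel_left _ hpos] at h2

lemma inputRep_inputState {K : ℕ} (hL : L.toFinset = G.E)
    (hK : 2 + n + L.length + G.maxWeight w + M + p + q ≤ K) :
    (ofGame hn G w L M p q).InputRep K (inputState G w L M p q) where
  r0 := rfl
  r1 := rfl
  r2 := rfl
  r3 := rfl
  r4 := rfl
  a0 u := by
    simp only [inputState, ofGame]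
    refine if_congr ⟨?_, fun h => ⟨u, h, rfl⟩⟩ rfl rfl
    rintro ⟨v, hv, h⟩
    rwa [← Fin.ext h]
  a1 i hi := by
    have hi' : i < L.length := hi
    simp [inputState, ofGame, hi']
  a2 i hi := by
    have hi' : i < L.length := hi
    simp [inputState, ofGame, hi']
  a3 i hi := by
    have hi' : i < L.length := hi
    simp [inputState, ofGame, hi']
  bdd := by
    constructor
    · intro x
      simp only [inputState]
      split <;> simp <;> omega
    · intro a i
      simp only [inputState]
      split
      · split_ifs <;> simp; omega
      · split_ifs with h
        · have := L[i].1.2; rw [Int.natAbs_natCast]; omega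
        · simp
      · split_ifs with h
        · have := L[i].2.2; rw [Int.natAbs_natCast]; omega
        · simp
      · split_ifs with h
        · have h1 : L[i] ∈ G.E := by
            rw [← hL, List.mem_toFinset]
            exact List.getElem_mem h
          have h2 : (w L[i].1 L[i].2).natAbs ≤ G.maxWeight w :=
            Finset.le_sup (f := fun e : Fin n × Fin n => (w e.1 e.2).natAbs) h1
          omega
        · simp
      · simp

end

end EdgeListGame

lemma GameGraph.card_le_card_edges {n : ℕ} (G : GameGraph (Fin n)) : n ≤ G.E.card := by
  have h : (Finset.univ : Finset (Fin n)) ⊆ G.E.image Prod.fst := by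
    intro u _
    obtain ⟨v, hv⟩ := G.exists_out u
    exact Finset.mem_image.2 ⟨_, hv, rfl⟩
  have := (Finset.card_le_card h).trans Finset.card_image_le
  rwa [Finset.card_univ, Fintype.card_fin] at this

open EdgeListGame in
theorem mainTheorem9 :
    ∃ (P : WordRAM.Prog) (C : ℝ) (k : ℕ),
      ∀ (n : ℕ) (_ : 0 < n) (G : GameGraph (Fin n)) (w : Fin n → Fin n → ℤ)
        (L : List (Fin n × Fin n)) (_ : L.Nodup) (_ : L.toFinset = G.E)
        (M p q : ℕ) (_ : 0 < q) (D : ℝ≥0) (_ : D = (p : ℝ≥0) / (q : ℝ≥0))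
        (_ : G.IsEnergyBound w M) (_ : (D : ℝ≥0∞) ≤ G.penalty w),
        ∃ (t : ℕ) (s : WordRAM.State),
          WordRAM.Exec ((2 + n + G.E.card + G.maxWeight w + M + p + q) ^ k) P
            (inputState G w L M p q) t s ∧
          OutputsEnergy s (G.minEnergy w) ∧
          (t : ℝ) ≤ C * ((G.E.card : ℝ) * (n : ℝ) * max 0 (Real.log (D : ℝ)) +
            (G.E.card : ℝ) * ((M : ℝ) / ((max 1 ⌈D⌉₊ : ℕ) : ℝ) + 1)) ∧
          ((M : ℝ) / (2 * (n : ℝ)) ≤ (D : ℝ) →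
            (t : ℝ) ≤ C * ((G.E.card : ℝ) * (n : ℝ) *
              max 1 (Real.log ((M : ℝ) / (n : ℝ))))) := by
  -- The factor 10 comes from the two running time estimates. The 5 comes from the memory bound `N ^
  -- 5`, which dominates the potentials of all phases.
  refine ⟨EnergyProgram.main, timeConst * 10, 5 * EnergyProgram.exponent, ?_⟩
  intro n hn G w L hnd hL M p q hq D hD hM hpen
  have hlen : L.length = G.E.card := by rw [← hL, List.toFinset_card_of_nodup hnd]
  rw [← hlen]
  have hnm : n ≤ L.length := hlen ▸ G.card_le_card_edges
  have hex : ∃ J, ¬ (2 ^ (J + 1) * q ≤ p ∧ 2 ^ (J + 1) * (2 * n) ≤ M) := by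
    refine ⟨M, fun h => ?_⟩
    have h1 : M < 2 ^ M := Nat.lt_two_pow_self
    have h2 : 2 ^ M ≤ 2 ^ (M + 1) := Nat.pow_le_pow_right (by norm_num) (by omega)
    have h3 : 2 ^ (M + 1) ≤ 2 ^ (M + 1) * (2 * n) := Nat.le_mul_of_pos_right _ (by omega)
    omega
  -- `J` is the first exponent at which another doubling is refused.
  obtain ⟨J, hJ', hJ⟩ : ∃ J, ¬ (2 ^ (J + 1) * q ≤ p ∧ 2 ^ (J + 1) * (2 * n) ≤ M) ∧
      ∀ j < J, 2 ^ (j + 1) * q ≤ p ∧ 2 ^ (j + 1) * (2 * n) ≤ M :=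
    ⟨Nat.find hex, Nat.find_spec hex, fun j hj => not_not.1 (Nat.find_min hex hj)⟩
  have hDle : ∀ B : ℕ, (B : ℝ≥0) ≤ D ↔ B * q ≤ p := by
    intro B
    rw [hD, le_div_iff₀ (by exact_mod_cast hq)]
    exact_mod_cast Iff.rfl
  have hDle' : ∀ j : ℕ, (2 : ℝ) ^ j ≤ D ↔ 2 ^ j * q ≤ p := by
    intro j
    rw [← hDle]
    push_cast
    exact_mod_cast Iff.rfl
  obtain ⟨N, hN⟩ : ∃ N, N = 2 + n + L.length + G.maxWeight w + M + p + q := ⟨_, rfl⟩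
  rw [← hN]
  have hN5 : N ≤ N ^ 5 := Nat.le_self_pow (by norm_num) N
  -- The potentials are at most `10 * N ^ 2`, and `N ≥ 4` makes `N ^ 3` exceed 10.
  have hNbig : 10 * (N * N) ≤ N ^ 5 := by
    have h5 : 4 ≤ N := by omega
    have h6 : 4 * 4 * 4 ≤ N * N * N := Nat.mul_le_mul (Nat.mul_le_mul h5 h5) h5
    calc 10 * (N * N) ≤ (N * N * N) * (N * N) := Nat.mul_le_mul_right _ (by omega)
      _ = N ^ 5 := by ring
  have hmN : 3 * L.length + 2 * n ≤ 5 * N := by omega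
  have hr1 : (M + 2) * (3 * L.length + 2 * n) ≤ N ^ 5 := by
    have := Nat.mul_le_mul (show M + 2 ≤ N by omega) hmN
    have e : N * (5 * N) = 5 * (N * N) := by ring
    omega
  have hr2 : (2 * n + 1) * (3 * L.length + 2 * n) ≤ N ^ 5 := by
    have := Nat.mul_le_mul (show 2 * n + 1 ≤ 2 * N by omega) hmN
    have e : 2 * N * (5 * N) = 10 * (N * N) := by ring
    omega
  have hE : (ofGame hn G w L M p q).Energies J fun j =>
      G.minEnergy fun a b => roundUp (2 ^ j) (w a b) := by
    refine energies_ofGame hL hM fun j hj => le_trans ?_ hpen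
    rw [← ENNReal.coe_natCast]
    exact ENNReal.coe_le_coe.2 ((hDle _).2 (hJ j hj).1)
  obtain ⟨t, s, hexec, ht, hout⟩ := runs_main (g := ofGame hn G w L M p q) (K := N ^ 5)
    (β := N ^ (5 * EnergyProgram.exponent)) (J := J) hn hnm (le_trans (by omega) hN5)
    (le_trans (show L.length ≤ N by omega) hN5) (le_trans (show M ≤ N by omega) hN5)
    (le_trans (show p ≤ N by omega) hN5) hq (pow_mul N 5 _).ge hJ hJ' hE hr1 hr2
    (inputRep_inputState hL (hN ▸ hN5)) (fun _ => rfl) (fun _ => rfl) (fun _ => rfl)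
  have htime : (t : ℝ) ≤ timeConst * ((L.length : ℝ) * (M / 2 ^ J + 1) + J * (L.length * n)) := by
    have h1 : (t : ℝ) ≤ ((timeConst * (L.length * (M / 2 ^ J + 1) + J * (L.length * n)) : ℕ) : ℝ) := by
      exact_mod_cast ht
    refine h1.trans ?_
    push_cast
    have h2 : ((M / 2 ^ J : ℕ) : ℝ) ≤ (M : ℝ) / 2 ^ J := by
      have := Nat.cast_div_le (α := ℝ) (m := M) (n := 2 ^ J)
      rwa [Nat.cast_pow, Nat.cast_ofNat] at this
    gcongr
  have hJD : J ≠ 0 → (2 : ℝ) ^ J ≤ D ∧ (2 : ℝ) ^ J * (2 * n) ≤ M := by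
    intro h
    have := hJ (J - 1) (by omega)
    rw [Nat.sub_add_cancel (by omega)] at this
    exact ⟨(hDle' J).2 this.1, by exact_mod_cast this.2⟩
  have hJM : (2 : ℝ) ^ (J + 1) ≤ D → (M : ℝ) < 2 ^ (J + 1) * (2 * n) := by
    intro h
    have h1 : ¬ 2 ^ (J + 1) * (2 * n) ≤ M := fun h2 => hJ' ⟨(hDle' (J + 1)).1 h, h2⟩
    exact_mod_cast not_le.1 h1
  refine ⟨t, s, hexec, fun v => ?_, ?_, fun h => ?_⟩
  · rw [hout v]
    simp [roundUp_one]
  · have h1 := time_le_first (m := L.length) (n := n) (M := M) (fun h => (hJD h).1) hJM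
    rw [show ⌈(D : ℝ)⌉₊ = ⌈D⌉₊ from Nonneg.nat_ceil_coe D] at h1
    refine htime.trans ?_
    rw [mul_assoc]
    exact mul_le_mul_of_nonneg_left h1 (Nat.cast_nonneg _)
  · have h1 := time_le_second (m := L.length) hn (fun h => (hJD h).2) hJM h
    refine htime.trans ?_
    rw [mul_assoc]
    exact mul_le_mul_of_nonneg_left h1 (Nat.cast_nonneg _)

end
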